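/- For $\varepsilon>0$ consider on $[0,\infty)\times\mathbb R^3$ the Cauchy problem (with viscosity and heat conductivity normalised to $1$) $$\begin{cases}\partial_t u^\varepsilon+\nabla p^\varepsilon=\Delta u^\varepsilon-(u^\varepsilon\cdot\nabla)u^\varepsilon-\tfrac12(\operatorname{div}u^\varepsilon)u^\varepsilon,\\ \partial_t\theta^\varepsilon+u^\varepsilon\cdot\nabla\theta^\varepsilon=\Delta\theta^\varepsilon-\tfrac12(\operatorname{div}u^\varepsilon)\theta^\varepsilon,\\ \varepsilon\,\partial_t p^\varepsilon+\operatorname{div}u^\varepsilon=0,\end{cases}\qquad (u^\varepsilon,\theta^\varepsilon,p^\varepsilon)|_{t=0}=(u_0^\varepsilon,\theta_0^\varepsilon,p_0^\varepsilon)\in L^2(\mathbb R^3),$$ with $u^\varepsilon$ valued in $\mathbb R^3$ and $\theta^\varepsilon,p^\varepsilon$ valued in $\mathbb R$. A finite energy (Leray type) weak solution is a triple with $u^\varepsilon,\theta^\varepsilon\in L^\infty([0,T];L^2(\mathbb R^3))\cap L^2([0,T];\dot H^1(\mathbb R^3))$ and $\sqrt\varepsilon\,p^\varepsilon\in L^\infty([0,T];L^2(\mathbb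 R^3))$ for all $T>0$, which satisfies the system and the initial conditions in the weak sense (tested with functions in $C_c^\infty([0,\infty)\times\mathbb R^3)$), and for which the energy inequality $$E^\varepsilon(t)+\int_0^t\!\!\int_{\mathbb R^3}\big(|\nabla u^\varepsilon|^2+|\nabla\theta^\varepsilon|^2\big)\,dx\,ds\le E^\varepsilon(0)$$ holds for almost every $t>0$, where $$E^\varepsilon(t)=\int_{\mathbb R^3}\Big(\tfrac12|u^\varepsilon(t)|^2+\tfrac12|\theta^\varepsilon(t)|^2+\tfrac\varepsilon2|p^\varepsilon(t)|^2\Big)dx \quad (t>0)$$ and $E^\varepsilon(0)$ is the same expression in the initial data. Let $\varepsilon$ run through a sequence of positive numbers tending to $0$, let $(u^\varepsilon,\theta^\varepsilon,p^\varepsilon)$ be finite energy weak solutions, and assume that there are $u_0,\theta_0\in L^2(\mathbb R^3)$ with $u_0^\varepsilon\to u_0$, $\theta_0^\varepsilon\to\theta_0$ and $\sqrt\varepsilon\,p_0^\varepsilon\to0$ strongly in $L^2(\mathbb R^3)$. Then for every $T>0$ there is a constant $C_T$, independent of $\varepsilon$ and $h$, such that for all $\varepsilon$ in the sequence and all $h\in(0,1)$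 $$\|\theta^\varepsilon(\cdot+h)-\theta^\varepsilon\|_{L^2([0,T]\times\mathbb R^3)}\le C_T\,h^{1/5}.$$ -/

import Mathlib

open MeasureTheory Filter Topology Set
open scoped ContDiff ENNReal NNReal

noncomputable section

namespace NSF

/-- Euclidean three-space. -/
abbrev Space : Type := EuclideanSpace ℝ (Fin 3)

/-- The measure `dt dx` on the slab `(0,T) × ℝ³`. -/
def slab (T : ℝ) : Measure (ℝ × Space) :=
  (volume.restrict (Ioo 0 T)).prod volume

/-- Smooth compactly supported scalar functions on a normed space. -/
def IsTest {V : Type*} [NormedAddCommGroup V] [NormedSpace ℝ V] (φ : V → ℝ) : Prop :=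
  ContDiff ℝ ∞ φ ∧ HasCompactSupport φ

/-- `G` is the weak (distributional) gradient of the scalar function `f` on `ℝ³`. -/
def HasWeakGradient (f : Space → ℝ) (G : Space → Space) : Prop :=
  LocallyIntegrable f volume ∧ LocallyIntegrable G volume ∧
    ∀ ψ : Space → ℝ, IsTest ψ → ∀ i : Fin 3,
      ∫ x, f x * fderiv ℝ ψ x (EuclideanSpace.single i 1) = - ∫ x, G x i * ψ x

/-- `f ∈ L^∞([0,T]; L²(ℝ³))` for every `T > 0`. -/
def LinftyL2 {F : Type*} [NormedAddCommGroup F] (f : ℝ → Space → F) : Prop :=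
  ∀ T : ℝ, 0 < T →
    AEStronglyMeasurable (fun z : ℝ × Space => f z.1 z.2) (slab T) ∧
    ∃ M : ℝ≥0, ∀ᵐ t ∂(volume.restrict (Ioo 0 T)), eLpNorm (f t) 2 volume ≤ M

/-- `G` is the spatial gradient of `f`, with `G ∈ L²([0,T] × ℝ³)` for every `T > 0`;
that is, `f ∈ L²([0,T]; Ḣ¹(ℝ³))` with `∇f = G`. -/
def HasL2SpatialGradient (f : ℝ → Space → ℝ) (G : ℝ → Space → Space) : Prop :=
  (∀ T : ℝ, 0 < T → MemLp (fun z : ℝ × Space => G z.1 z.2) 2 (slab T)) ∧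
    ∀ᵐ t ∂(volume.restrict (Ioi (0 : ℝ))), HasWeakGradient (f t) (G t)

/-- Time derivative of a function on space-time. -/
def dt (φ : ℝ × Space → ℝ) (t : ℝ) (x : Space) : ℝ := fderiv ℝ φ (t, x) (1, 0)

/-- Spatial directional derivative `v · ∇φ` of a function on space-time. -/
def dx (φ : ℝ × Space → ℝ) (t : ℝ) (x v : Space) : ℝ := fderiv ℝ φ (t, x) (0, v)

/-- Divergence of a velocity field whose `i`-th component has gradient `Du i`. -/
def divergence (Du : Fin 3 → ℝ → Space → Space) (t : ℝ) (x : Space) : ℝ :=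
  ∑ i, Du i t x i

/-- Weak form, on `[0,∞) × ℝ³` with initial value `u₀`, of
`∂ₜu + ∇p = Δu - (u·∇)u - ½ (div u) u`, written component by component;
`Du i` is the gradient of the `i`-th component of `u`. -/
def MomentumEq (u₀ : Space → Space) (u : ℝ → Space → Space)
    (Du : Fin 3 → ℝ → Space → Space) (p : ℝ → Space → ℝ) : Prop :=
  ∀ i : Fin 3, ∀ φ : ℝ × Space → ℝ, IsTest φ →
    ∫ t in Ioi (0 : ℝ), ∫ x,
        (- (u t x i * dt φ t x) - p t x * dx φ t x (EuclideanSpace.single i 1)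
          + dx φ t x (Du i t x)
          + (inner ℝ (u t x) (Du i t x) + 1 / 2 * divergence Du t x * u t x i) * φ (t, x))
      = ∫ x, u₀ x i * φ (0, x)

/-- Weak form, on `[0,∞) × ℝ³` with initial value `θ₀`, of
`∂ₜθ + u·∇θ = Δθ - ½ (div u) θ`. -/
def TemperatureEq (θ₀ : Space → ℝ) (u : ℝ → Space → Space)
    (Du : Fin 3 → ℝ → Space → Space) (θ : ℝ → Space → ℝ) (Dθ : ℝ → Space → Space) : Prop :=
  ∀ φ : ℝ × Space → ℝ, IsTest φ →
    ∫ t in Ioi (0 : ℝ), ∫ x,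
        (- (θ t x * dt φ t x) + dx φ t x (Dθ t x)
          + (inner ℝ (u t x) (Dθ t x) + 1 / 2 * divergence Du t x * θ t x) * φ (t, x))
      = ∫ x, θ₀ x * φ (0, x)

/-- Weak form, on `[0,∞) × ℝ³` with initial value `p₀`, of `ε ∂ₜp + div u = 0`. -/
def PressureEq (ε : ℝ) (p₀ : Space → ℝ) (Du : Fin 3 → ℝ → Space → Space)
    (p : ℝ → Space → ℝ) : Prop :=
  ∀ φ : ℝ × Space → ℝ, IsTest φ →
    ∫ t in Ioi (0 : ℝ), ∫ x,
        (- (ε * p t x * dt φ t x) + divergence Du t x * φ (t, x))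
      = ε * ∫ x, p₀ x * φ (0, x)

/-- The energy `∫ (½|u|² + ½|θ|² + (ε/2)|p|²) dx` of a state. -/
def energy (ε : ℝ) (u : Space → Space) (θ p : Space → ℝ) : ℝ≥0∞ :=
  ∫⁻ x, ENNReal.ofReal (1 / 2 * ‖u x‖ ^ 2 + 1 / 2 * θ x ^ 2 + ε / 2 * p x ^ 2)

/-- The dissipation `∫₀ᵗ ∫ (|∇u|² + |∇θ|²) dx ds`. -/
def dissipation (Du : Fin 3 → ℝ → Space → Space) (Dθ : ℝ → Space → Space) (t : ℝ) : ℝ≥0∞ :=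
  ∫⁻ s in Ioo 0 t, ∫⁻ x, ENNReal.ofReal ((∑ i, ‖Du i s x‖ ^ 2) + ‖Dθ s x‖ ^ 2)

/-- `(u, θ, p)` is a global finite energy (Leray type) weak solution of the artificial
compressibility approximation of the Navier-Stokes-Fourier system, with parameter `ε`, unit
viscosity and heat conductivity, and initial data `(u₀, θ₀, p₀)`. As for Leray solutions of the
Navier-Stokes equations, the energy inequality belongs to the notion of solution. -/
def IsFiniteEnergyWeakSolution (ε : ℝ) (u₀ : Space → Space) (θ₀ p₀ : Space → ℝ)
    (u : ℝ → Space → Space) (θ p : ℝ → Space → ℝ) : Prop :=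
  LinftyL2 u ∧ LinftyL2 θ ∧ LinftyL2 (fun t x => √ε * p t x) ∧
  ∃ (Du : Fin 3 → ℝ → Space → Space) (Dθ : ℝ → Space → Space),
    (∀ i, HasL2SpatialGradient (fun t x => u t x i) (Du i)) ∧
    HasL2SpatialGradient θ Dθ ∧
    MomentumEq u₀ u Du p ∧
    TemperatureEq θ₀ u Du θ Dθ ∧
    PressureEq ε p₀ Du p ∧
    ∀ᵐ t ∂(volume.restrict (Ioi (0 : ℝ))),
      energy ε (u t) (θ t) (p t) + dissipation Du Dθ t ≤ energy ε u₀ θ₀ p₀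

/-- Convergence of the initial data: `u₀ⁿ → u₀`, `θ₀ⁿ → θ₀` and `√εₙ p₀ⁿ → 0` strongly in
`L²(ℝ³)`, all functions being square integrable. -/
def InitialDataConverge (ε : ℕ → ℝ) (u₀ : ℕ → Space → Space) (θ₀ p₀ : ℕ → Space → ℝ)
    (u₀lim : Space → Space) (θ₀lim : Space → ℝ) : Prop :=
  (∀ n, MemLp (u₀ n) 2 volume) ∧ (∀ n, MemLp (θ₀ n) 2 volume) ∧
  (∀ n, MemLp (p₀ n) 2 volume) ∧ MemLp u₀lim 2 volume ∧ MemLp θ₀lim 2 volume ∧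
  Tendsto (fun n => eLpNorm (fun x => u₀ n x - u₀lim x) 2 volume) atTop (𝓝 0) ∧
  Tendsto (fun n => eLpNorm (fun x => θ₀ n x - θ₀lim x) 2 volume) atTop (𝓝 0) ∧
  Tendsto (fun n => eLpNorm (fun x => √(ε n) * p₀ n x) 2 volume) atTop (𝓝 0)

end NSF

end

namespace NSF

/-! ### Quadratic integral inequalities -/

section Inequalities

/-! The pressure does not enter the temperature equation, which reads `∂ₜθ = div ∇θ - g` with `g =
u·∇θ + ½ (div u) θ`. The energy inequality bounds `u, θ` in `L^∞_t L²_x` and `∇u, ∇θ` in `L²_t L²_x`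
by the initial energy, uniformly in `ε`. Hence `g` is bounded in `L²_t L¹_x`, and a time modulus
follows by interpolating between spatial regularity and a weak bound on `∂ₜθ`.

Let `κ` be a smooth probability density at scale `a`, and compare `θ` with its spatial average
against `κ`. Replacing `θ` by the average costs `a ‖∇θ‖` in `L²`
(`HasWeakGradient.lintegral_sq_sub_average_le`). The average has a genuine time derivative, the
averaged flux, whose `L²` norm is at most `‖∇κ‖₁ ‖∇θ‖₂ + ‖κ‖₂ ‖g‖₁`, of order `a⁻¹ + a^(-3/2)`
(`lintegral_sq_averagedFlux_le`, `exists_mollifier`). Over a time step `h` the squared increment is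
therefore at most a constant times `a² + h² (a⁻² + a⁻³)`
(`IsWeakSolution.lintegral_sq_increment_le`).

With `a = h^(1/5)` this is `a² + a⁸ + a⁷`, hence of order `h^(2/5)`, and the root is `h^(1/5)`. All
estimates hold on `(0,∞)`, so the constant depends on the energy bound alone. -/

theorem sq_lintegral_mul_le {α : Type*} [MeasurableSpace α] {μ : Measure α} {f g : α → ℝ≥0∞}
    (hf : AEMeasurable f μ) (hg : AEMeasurable g μ) :
    (∫⁻ a, f a * g a ∂μ) ^ 2 ≤ (∫⁻ a, f a ^ 2 ∂μ) * ∫⁻ a, g a ^ 2 ∂μ := by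
  have h := ENNReal.lintegral_mul_le_Lp_mul_Lq μ Real.HolderConjugate.two_two hf hg
  simp only [Pi.mul_apply, ENNReal.rpow_two] at h
  calc _ ≤ _ := pow_le_pow_left' h 2
    _ = _ := by
      rw [mul_pow, ← ENNReal.rpow_two, ← ENNReal.rpow_two, ← ENNReal.rpow_mul, ← ENNReal.rpow_mul]
      norm_num

theorem sq_lintegral_le {α : Type*} [MeasurableSpace α] {μ : Measure α} {f : α → ℝ≥0∞}
    (hf : AEMeasurable f μ) :
    (∫⁻ a, f a ∂μ) ^ 2 ≤ μ univ * ∫⁻ a, f a ^ 2 ∂μ := by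
  simpa using sq_lintegral_mul_le (μ := μ) (f := fun _ => 1) aemeasurable_const hf

/-- Cauchy–Schwarz against the constant `1` for the measure with density `w`. -/
theorem sq_lintegral_mul_le_weighted {α : Type*} [MeasurableSpace α] {μ : Measure α}
    {w f : α → ℝ≥0∞} (hw : Measurable w) (hf : Measurable f) :
    (∫⁻ a, w a * f a ∂μ) ^ 2 ≤ (∫⁻ a, w a ∂μ) * ∫⁻ a, w a * f a ^ 2 ∂μ := by
  have h := sq_lintegral_le (μ := μ.withDensity w) hf.aemeasurable
  rw [lintegral_withDensity_eq_lintegral_mul μ hw hf,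
    lintegral_withDensity_eq_lintegral_mul μ hw (hf.pow_const 2),
    withDensity_apply _ MeasurableSet.univ, Measure.restrict_univ] at h
  simpa using h

variable {E : Type*} [AddCommGroup E] [MeasurableSpace E] [MeasurableAdd₂ E]
  {μ : Measure E} [SFinite μ] [μ.IsAddLeftInvariant]

/-- Averages of translates contract the `L²` norm, up to the mass of the weight. -/
theorem lintegral_sq_average_le {κ f : E → ℝ≥0∞} (hκ : Measurable κ) (hf : Measurable f) :
    ∫⁻ x, (∫⁻ y, κ y * f (x + y) ∂μ) ^ 2 ∂μ ≤ (∫⁻ y, κ y ∂μ) ^ 2 * ∫⁻ x, f x ^ 2 ∂μ := by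
  calc ∫⁻ x, (∫⁻ y, κ y * f (x + y) ∂μ) ^ 2 ∂μ
      ≤ ∫⁻ x, (∫⁻ y, κ y ∂μ) * ∫⁻ y, κ y * f (x + y) ^ 2 ∂μ ∂μ :=
        lintegral_mono fun x => sq_lintegral_mul_le_weighted hκ (by fun_prop)
    _ = (∫⁻ y, κ y ∂μ) * ∫⁻ x, ∫⁻ y, κ y * f (x + y) ^ 2 ∂μ ∂μ := by
        rw [lintegral_const_mul _ (by fun_prop)]
    _ = (∫⁻ y, κ y ∂μ) * ∫⁻ y, ∫⁻ x, κ y * f (x + y) ^ 2 ∂μ ∂μ := by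
        rw [lintegral_lintegral_swap (by fun_prop)]
    _ = (∫⁻ y, κ y ∂μ) * ∫⁻ y, κ y * ∫⁻ x, f x ^ 2 ∂μ ∂μ := by
        congr 1
        refine lintegral_congr fun y => ?_
        rw [lintegral_const_mul _ (by fun_prop),
          lintegral_add_right_eq_self (fun x => f x ^ 2) y]
    _ = _ := by rw [lintegral_mul_const _ hκ]; ring

/-- The other endpoint of Young's inequality: a change of variables makes `f` the weight and `κ` the
averaged function. It serves the transport term, which is only `L¹` in space. -/
theorem lintegral_sq_average_le' [MeasurableNeg E] [μ.IsNegInvariant] {κ f : E → ℝ≥0∞}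
    (hκ : Measurable κ) (hf : Measurable f) :
    ∫⁻ x, (∫⁻ y, κ y * f (x + y) ∂μ) ^ 2 ∂μ ≤ (∫⁻ y, κ y ^ 2 ∂μ) * (∫⁻ x, f x ∂μ) ^ 2 := by
  have h : ∀ x, ∫⁻ y, κ y * f (x + y) ∂μ = ∫⁻ y, f y * κ (y + -x) ∂μ := fun x => by
    rw [← lintegral_add_left_eq_self (fun y => f y * κ (y + -x)) x]
    refine lintegral_congr fun y => ?_
    rw [mul_comm, add_comm x y, add_neg_cancel_right]
  simp only [h]
  calc ∫⁻ x, (∫⁻ y, f y * κ (y + -x) ∂μ) ^ 2 ∂μ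
      ≤ ∫⁻ x, (∫⁻ y, f y ∂μ) * ∫⁻ y, f y * κ (y + -x) ^ 2 ∂μ ∂μ :=
        lintegral_mono fun x => sq_lintegral_mul_le_weighted hf (by fun_prop)
    _ = (∫⁻ y, f y ∂μ) * ∫⁻ x, ∫⁻ y, f y * κ (y + -x) ^ 2 ∂μ ∂μ := by
        rw [lintegral_const_mul _ (by fun_prop)]
    _ = (∫⁻ y, f y ∂μ) * ∫⁻ y, ∫⁻ x, f y * κ (y + -x) ^ 2 ∂μ ∂μ := by
        rw [lintegral_lintegral_swap (by fun_prop)]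
    _ = (∫⁻ y, f y ∂μ) * ∫⁻ y, f y * ∫⁻ x, κ x ^ 2 ∂μ ∂μ := by
        congr 1
        refine lintegral_congr fun y => ?_
        rw [lintegral_const_mul _ (by fun_prop)]
        congr 1
        have := lintegral_neg_eq_self (μ := μ) (fun x => κ (y + x) ^ 2)
        rw [this, lintegral_add_left_eq_self (fun x => κ x ^ 2) y]
    _ = _ := by rw [lintegral_mul_const _ hf]; ring

end Inequalities

/-- Cauchy–Schwarz on a window of length `h` gives one factor `h`, integration over the window the
other. Forward shifts map the half-line into itself, so no values at negative times appear. -/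
theorem lintegral_sq_forward_average_le {f : ℝ → ℝ≥0∞} (hf : Measurable f) (h : ℝ) :
    ∫⁻ t in Ioi 0, (∫⁻ r in Ioo 0 h, f (t + r)) ^ 2
      ≤ ENNReal.ofReal h ^ 2 * ∫⁻ t in Ioi 0, f t ^ 2 := by
  calc ∫⁻ t in Ioi 0, (∫⁻ r in Ioo 0 h, f (t + r)) ^ 2
      ≤ ∫⁻ t in Ioi 0, ENNReal.ofReal h * ∫⁻ r in Ioo 0 h, f (t + r) ^ 2 :=
        lintegral_mono fun t => (sq_lintegral_le (by fun_prop)).trans_eq (by simp)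
    _ = ENNReal.ofReal h * ∫⁻ r in Ioo 0 h, ∫⁻ t in Ioi 0, f (t + r) ^ 2 := by
        rw [lintegral_const_mul _ (by fun_prop), lintegral_lintegral_swap (by fun_prop)]
    _ ≤ ENNReal.ofReal h * ∫⁻ r in Ioo 0 h, ∫⁻ t in Ioi 0, f t ^ 2 := by
        gcongr ENNReal.ofReal h * ?_
        refine setLIntegral_mono' measurableSet_Ioo fun r hr => ?_
        rw [← lintegral_indicator measurableSet_Ioi, ← lintegral_indicator measurableSet_Ioi,
          ← lintegral_add_right_eq_self (indicator (Ioi 0) fun t => f t ^ 2) r]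
        refine lintegral_mono fun t => ?_
        by_cases ht : t ∈ Ioi (0 : ℝ)
        · have htr : t + r ∈ Ioi (0 : ℝ) := add_pos ht hr.1
          simp only [indicator_of_mem ht, indicator_of_mem htr, le_refl]
        · simp only [indicator_of_notMem ht, zero_le]
    _ = _ := by simp; ring

/-! ### Translates and averages of functions with a weak gradient -/

theorem HasWeakGradient.integral_mul_fderiv {f : Space → ℝ} {G : Space → Space}
    (h : HasWeakGradient f G) {ψ : Space → ℝ} (hψ : IsTest ψ) (v : Space) :
    ∫ x, f x * fderiv ℝ ψ x v = - ∫ x, inner ℝ (G x) v * ψ x := by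
  obtain ⟨hf, hG, hw⟩ := h
  have hv : v = ∑ i, v i • EuclideanSpace.single i (1 : ℝ) := by
    ext j; simp [Fin.sum_univ_three]; fin_cases j <;> simp
  have h1 : ∀ x, f x * fderiv ℝ ψ x v
      = ∑ i, v i * (f x * fderiv ℝ ψ x (EuclideanSpace.single i 1)) := fun x => by
    conv_lhs => rw [hv]
    rw [map_sum, Finset.mul_sum]
    refine Finset.sum_congr rfl fun i _ => ?_
    rw [map_smul, smul_eq_mul]; ring
  have h2 : ∀ x, inner ℝ (G x) v * ψ x = ∑ i, v i * (G x i * ψ x) := fun x => by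
    rw [PiLp.inner_apply, Finset.sum_mul]
    refine Finset.sum_congr rfl fun i _ => ?_
    simp; ring
  simp only [h1, h2]
  have hcf : ∀ v, Continuous fun x => fderiv ℝ ψ x v := fun v =>
    (hψ.1.continuous_fderiv (by simp)).clm_apply continuous_const
  have hcs : ∀ v, HasCompactSupport fun x => fderiv ℝ ψ x v := fun v =>
    (hψ.2.fderiv ℝ).comp_left (g := fun L : Space →L[ℝ] ℝ => L v) (by simp)
  have i1 : ∀ i, Integrable fun x => f x * fderiv ℝ ψ x (EuclideanSpace.single i 1) := fun i => by
    simpa [mul_comm] using hf.integrable_smul_left_of_hasCompactSupport (hcf _) (hcs _)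
  have i2 : ∀ i, Integrable fun x => G x i * ψ x := fun i => by
    have := hG.integrable_smul_left_of_hasCompactSupport hψ.1.continuous hψ.2
    have := (EuclideanSpace.proj (𝕜 := ℝ) i).integrable_comp this
    simpa [mul_comm] using this
  rw [integral_finsetSum _ fun i _ => (i1 i).const_mul _,
    integral_finsetSum _ fun i _ => (i2 i).const_mul _, ← Finset.sum_neg_distrib]
  refine Finset.sum_congr rfl fun i _ => ?_
  rw [integral_const_mul, integral_const_mul, hw ψ hψ i]; ring

/-- The derivative of the convolution falls on `ρ`. Since `x ↦ ρ (z - x)` is itself a test function,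
the weak gradient moves it to `f`; the reflection sign cancels the sign of integration by parts. -/
theorem HasWeakGradient.fderiv_convolution {f : Space → ℝ} {G : Space → Space}
    (h : HasWeakGradient f G) {ρ : Space → ℝ} (hρ : IsTest ρ) (z v : Space) :
    fderiv ℝ (convolution f ρ (ContinuousLinearMap.lsmul ℝ ℝ) volume) z v
      = ∫ x, inner ℝ (G x) v * ρ (z - x) := by
  have hd := hρ.2.hasFDerivAt_convolution_right (ContinuousLinearMap.lsmul ℝ ℝ) h.1
    (hρ.1.of_le (by simp)) z
  rw [hd.fderiv, convolution_precompR_apply _ h.1 (hρ.2.fderiv ℝ)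
    (hρ.1.continuous_fderiv (by simp))]
  have hψ : IsTest fun x => ρ (z - x) := by
    refine ⟨hρ.1.comp (contDiff_const.sub contDiff_id), ?_⟩
    exact hρ.2.comp_homeomorph (Homeomorph.subLeft z)
  have h1 := h.integral_mul_fderiv hψ v
  have h2 : ∀ x, fderiv ℝ (fun x => ρ (z - x)) x v = - fderiv ℝ ρ (z - x) v := fun x => by
    have hd : HasFDerivAt ρ (fderiv ℝ ρ (z - x)) (z - x) :=
      (hρ.1.differentiable (by simp) _).hasFDerivAt
    have := hd.comp x ((hasFDerivAt_id (𝕜 := ℝ) x).const_sub z)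
    change fderiv ℝ (ρ ∘ HSub.hSub z) x v = _
    rw [this.fderiv]
    simp
  simp only [h2, mul_neg, integral_neg, neg_inj] at h1
  simpa [convolution] using h1

/-- The mollified function is `C¹`, so its increment is the integral of its derivative along the
segment from `z` to `z + y`. Translation invariance removes the position on the segment, and Young's
inequality bounds the mollified gradient. -/
theorem HasWeakGradient.lintegral_sq_convolution_translate_sub_le {f : Space → ℝ}
    {G : Space → Space} (h : HasWeakGradient f G) (hG : Measurable G) {ρ : Space → ℝ}
    (hρ : IsTest ρ) (y : Space) :
    ∫⁻ z, ‖convolution f ρ (ContinuousLinearMap.lsmul ℝ ℝ) volume (z + y)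
        - convolution f ρ (ContinuousLinearMap.lsmul ℝ ℝ) volume z‖ₑ ^ 2
      ≤ ‖y‖ₑ ^ 2 * ((∫⁻ x, ‖ρ x‖ₑ) ^ 2 * ∫⁻ x, ‖G x‖ₑ ^ 2) := by
  set P := convolution f ρ (ContinuousLinearMap.lsmul ℝ ℝ) volume with hP
  have hPc : ContDiff ℝ 1 P :=
    hρ.2.contDiff_convolution_right _ h.1 (hρ.1.of_le (by simp))
  have hPf : Continuous (fderiv ℝ P) := hPc.continuous_fderiv (by simp)
  have hρm : Measurable ρ := hρ.1.continuous.measurable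
  have hmean : ∀ z, P (z + y) - P z = ∫ s in (0 : ℝ)..1, fderiv ℝ P (z + s • y) y := fun z => by
    have hd : ∀ s : ℝ, HasDerivAt (fun s : ℝ => P (z + s • y)) (fderiv ℝ P (z + s • y) y) s :=
      fun s => by
        have h1 : HasFDerivAt P (fderiv ℝ P (z + s • y)) (z + s • y) :=
          (hPc.differentiable (by simp) _).hasFDerivAt
        have h2 : HasDerivAt (fun s : ℝ => z + s • y) y s := by
          simpa using ((hasDerivAt_id s).smul_const y).const_add z
        exact h1.comp_hasDerivAt s h2
    rw [intervalIntegral.integral_eq_sub_of_hasDerivAt (fun s _ => hd s)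
      (Continuous.intervalIntegrable (by fun_prop) _ _)]
    simp
  have hsq : ∀ z, ‖P (z + y) - P z‖ₑ ^ 2
      ≤ ∫⁻ s in Ioc (0 : ℝ) 1, ‖fderiv ℝ P (z + s • y) y‖ₑ ^ 2 := fun z => by
    rw [hmean, intervalIntegral.integral_of_le zero_le_one]
    calc _ ≤ (∫⁻ s in Ioc (0 : ℝ) 1, ‖fderiv ℝ P (z + s • y) y‖ₑ) ^ 2 :=
          pow_le_pow_left' (enorm_integral_le_lintegral_enorm _) 2
      _ ≤ _ := by
          refine (sq_lintegral_le (Continuous.aemeasurable (by fun_prop))).trans_eq ?_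
          simp
  have hgrad : ∀ z, ‖fderiv ℝ P z y‖ₑ ≤ ‖y‖ₑ * ∫⁻ x, ‖ρ (-x)‖ₑ * ‖G (z + x)‖ₑ := fun z => by
    rw [hP, h.fderiv_convolution hρ]
    refine (enorm_integral_le_lintegral_enorm _).trans ?_
    rw [← lintegral_const_mul _ (by fun_prop),
      ← lintegral_add_left_eq_self (fun x => ‖inner ℝ (G x) y * ρ (z - x)‖ₑ) z]
    refine lintegral_mono fun x => ?_
    have hi : ‖(inner ℝ (G (z + x)) y : ℝ)‖ₑ ≤ ‖G (z + x)‖ₑ * ‖y‖ₑ := by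
      have := norm_inner_le_norm (𝕜 := ℝ) (G (z + x)) y
      simp only [enorm_eq_nnnorm]
      exact_mod_cast this
    rw [enorm_mul, sub_add_cancel_left]
    calc _ ≤ (‖G (z + x)‖ₑ * ‖y‖ₑ) * ‖ρ (-x)‖ₑ := by gcongr
      _ = _ := by ring
  calc ∫⁻ z, ‖P (z + y) - P z‖ₑ ^ 2
      ≤ ∫⁻ z, ∫⁻ s in Ioc (0 : ℝ) 1, ‖fderiv ℝ P (z + s • y) y‖ₑ ^ 2 := lintegral_mono hsq
    _ = ∫⁻ s in Ioc (0 : ℝ) 1, ∫⁻ z, ‖fderiv ℝ P (z + s • y) y‖ₑ ^ 2 := by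
        refine lintegral_lintegral_swap (Measurable.aemeasurable ?_)
        refine Continuous.measurable ?_
        simp only [Function.uncurry_def]
        fun_prop
    _ = ∫⁻ s in Ioc (0 : ℝ) 1, ∫⁻ z, ‖fderiv ℝ P z y‖ₑ ^ 2 := by
        refine lintegral_congr fun s => ?_
        exact lintegral_add_right_eq_self (fun z => ‖fderiv ℝ P z y‖ₑ ^ 2) (s • y)
    _ = ∫⁻ z, ‖fderiv ℝ P z y‖ₑ ^ 2 := by simp
    _ ≤ ∫⁻ z, (‖y‖ₑ * ∫⁻ x, ‖ρ (-x)‖ₑ * ‖G (z + x)‖ₑ) ^ 2 :=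
        lintegral_mono fun z => pow_le_pow_left' (hgrad z) 2
    _ = ‖y‖ₑ ^ 2 * ∫⁻ z, (∫⁻ x, ‖ρ (-x)‖ₑ * ‖G (z + x)‖ₑ) ^ 2 := by
        simp only [mul_pow]
        rw [lintegral_const_mul _ (by fun_prop)]
    _ ≤ _ := by
        gcongr ‖y‖ₑ ^ 2 * ?_
        refine (lintegral_sq_average_le (κ := fun x => ‖ρ (-x)‖ₑ) (f := fun x => ‖G x‖ₑ)
          (by fun_prop) (by fun_prop)).trans_eq ?_
        rw [lintegral_neg_eq_self (fun x => ‖ρ x‖ₑ)]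

/-- Mollifiers of unit mass give the bound with a constant independent of the scale; almost
everywhere convergence and Fatou's lemma carry it to `f`. -/
theorem HasWeakGradient.lintegral_sq_translate_sub_le {f : Space → ℝ} {G : Space → Space}
    (h : HasWeakGradient f G) (hG : Measurable G) (y : Space) :
    ∫⁻ x, ‖f (x + y) - f x‖ₑ ^ 2 ≤ ‖y‖ₑ ^ 2 * ∫⁻ x, ‖G x‖ₑ ^ 2 := by
  -- The ratio 2 of outer to inner radius stays fixed while both shrink, which is what almost
  -- everywhere convergence for a merely locally integrable `f` requires.
  let φ : ℕ → ContDiffBump (0 : Space) := fun n =>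
    ⟨1 / ((n : ℝ) + 1), 2 * (1 / ((n : ℝ) + 1)), by positivity, by
      have : 0 < 1 / ((n : ℝ) + 1) := by positivity
      linarith⟩
  have hφ : Tendsto (fun n => (φ n).rOut) atTop (𝓝 0) := by
    simpa [φ] using (tendsto_one_div_add_atTop_nhds_zero_nat (𝕜 := ℝ)).const_mul 2
  have hρ : ∀ n, IsTest ((φ n).normed volume) := fun n =>
    ⟨(φ n).contDiff_normed, (φ n).hasCompactSupport_normed⟩
  let P : ℕ → Space → ℝ := fun n =>
    convolution f ((φ n).normed volume) (ContinuousLinearMap.lsmul ℝ ℝ) volume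
  have hPc : ∀ n, Continuous (P n) := fun n =>
    (hρ n).2.continuous_convolution_right _ h.1 (hρ n).1.continuous
  have hlim : ∀ᵐ x, Tendsto (fun n => P n x) atTop (𝓝 (f x)) := by
    have := ContDiffBump.ae_convolution_tendsto_right_of_locallyIntegrable (K := 2) hφ
      (Eventually.of_forall fun n => le_rfl) h.1
    filter_upwards [this] with x hx
    refine hx.congr fun n => ?_
    rw [convolution_lsmul_swap]
    simp [P, convolution, mul_comm]
  have hlim' : ∀ᵐ x, Tendsto (fun n => P n (x + y)) atTop (𝓝 (f (x + y))) :=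
    (measurePreserving_add_right volume y).quasiMeasurePreserving.ae hlim
  have hmass : ∀ n, ∫⁻ x, ‖(φ n).normed volume x‖ₑ = 1 := fun n => by
    have h1 : ∀ x, ‖(φ n).normed volume x‖ₑ = ENNReal.ofReal ((φ n).normed volume x) := fun x =>
      Real.enorm_of_nonneg ((φ n).nonneg_normed x)
    simp only [h1]
    rw [← ofReal_integral_eq_lintegral_ofReal (φ n).integrable_normed
      (Eventually.of_forall fun x => (φ n).nonneg_normed x), (φ n).integral_normed]
    simp
  calc ∫⁻ x, ‖f (x + y) - f x‖ₑ ^ 2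
      = ∫⁻ x, liminf (fun n => ‖P n (x + y) - P n x‖ₑ ^ 2) atTop := by
        refine lintegral_congr_ae ?_
        filter_upwards [hlim, hlim'] with x h1 h2
        exact (((ENNReal.continuous_pow 2).tendsto _).comp (h2.sub h1).enorm).liminf_eq.symm
    _ ≤ liminf (fun n => ∫⁻ x, ‖P n (x + y) - P n x‖ₑ ^ 2) atTop := by
        refine lintegral_liminf_le fun n => ?_
        have := hPc n
        exact Continuous.measurable (by fun_prop)
    _ ≤ liminf (fun _ : ℕ => ‖y‖ₑ ^ 2 * ∫⁻ x, ‖G x‖ₑ ^ 2) atTop := by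
        refine liminf_le_liminf (Eventually.of_forall fun n => ?_)
        simpa [hmass n] using h.lintegral_sq_convolution_translate_sub_le hG (hρ n) y
    _ = _ := by simp

/-- A function with a square integrable gradient is close in `L²` to its average against a
probability density supported near the origin. -/
theorem HasWeakGradient.lintegral_sq_sub_average_le {f : Space → ℝ} {G : Space → Space}
    (h : HasWeakGradient f G) (hf : Measurable f) (hG : Measurable G) {κ : Space → ℝ}
    (hκ : IsTest κ) (hκ0 : ∀ y, 0 ≤ κ y) (hκ1 : ∫ y, κ y = 1) {α : ℝ}
    (hα : ∀ y, κ y ≠ 0 → ‖y‖ ≤ α) :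
    ∫⁻ x, ‖f x - ∫ y, κ y * f (x + y)‖ₑ ^ 2 ≤ ENNReal.ofReal α ^ 2 * ∫⁻ x, ‖G x‖ₑ ^ 2 := by
  have hκm : Measurable κ := hκ.1.continuous.measurable
  have hκi : Integrable κ := hκ.1.continuous.integrable_of_hasCompactSupport hκ.2
  have hmass : ∫⁻ y, ‖κ y‖ₑ = 1 := by
    have h1 : ∀ x, ‖κ x‖ₑ = ENNReal.ofReal (κ x) := fun x => Real.enorm_of_nonneg (hκ0 x)
    simp only [h1]
    rw [← ofReal_integral_eq_lintegral_ofReal hκi (Eventually.of_forall hκ0), hκ1]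
    simp
  have hpt : ∀ x, ‖f x - ∫ y, κ y * f (x + y)‖ₑ ≤ ∫⁻ y, ‖κ y‖ₑ * ‖f (x + y) - f x‖ₑ := fun x => by
    have hi : Integrable fun y => κ y * f (x + y) := by
      have h2 := h.1.integrable_smul_left_of_hasCompactSupport (g := fun z => κ (z + -x))
          (hκ.1.continuous.comp (by fun_prop))
          (hκ.2.comp_homeomorph (Homeomorph.addRight (-x)))
      simpa [add_comm x] using h2.comp_add_right x
    -- Unit mass of `κ` turns the error into an average of differences of translates.
    have : f x - ∫ y, κ y * f (x + y) = ∫ y, κ y * (f x - f (x + y)) := by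
      simp only [mul_sub]
      rw [integral_sub (hκi.mul_const _) hi, integral_mul_const, hκ1, one_mul]
    rw [this]
    refine (enorm_integral_le_lintegral_enorm _).trans_eq ?_
    simp only [enorm_mul, enorm_sub_rev]
  calc ∫⁻ x, ‖f x - ∫ y, κ y * f (x + y)‖ₑ ^ 2
      ≤ ∫⁻ x, (∫⁻ y, ‖κ y‖ₑ * ‖f (x + y) - f x‖ₑ) ^ 2 :=
        lintegral_mono fun x => pow_le_pow_left' (hpt x) 2
    _ ≤ ∫⁻ x, ∫⁻ y, ‖κ y‖ₑ * ‖f (x + y) - f x‖ₑ ^ 2 := by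
        refine lintegral_mono fun x => ?_
        refine (sq_lintegral_mul_le_weighted (by fun_prop) (by fun_prop)).trans_eq ?_
        rw [hmass, one_mul]
    _ = ∫⁻ y, ‖κ y‖ₑ * ∫⁻ x, ‖f (x + y) - f x‖ₑ ^ 2 := by
        rw [lintegral_lintegral_swap (by fun_prop)]
        refine lintegral_congr fun y => ?_
        rw [lintegral_const_mul _ (by fun_prop)]
    _ ≤ ∫⁻ y, ‖κ y‖ₑ * (ENNReal.ofReal α ^ 2 * ∫⁻ x, ‖G x‖ₑ ^ 2) := by
        refine lintegral_mono fun y => ?_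
        by_cases hy : κ y = 0
        · simp [hy]
        · gcongr ‖κ y‖ₑ * ?_
          refine (h.lintegral_sq_translate_sub_le hG y).trans ?_
          gcongr
          rw [← ofReal_norm]
          exact ENNReal.ofReal_le_ofReal (hα y hy)
    _ = _ := by rw [lintegral_mul_const _ (by fun_prop), hmass, one_mul]

section

open scoped Pointwise

/-! ### Integrated form of a weak evolution equation -/

theorem locallyIntegrable_comp_add_right {A : ℝ → ℝ} (hA : LocallyIntegrable A) (h : ℝ) :
    LocallyIntegrable fun t => A (t + h) := by
  rw [locallyIntegrable_iff] at hA ⊢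
  intro K hK
  have hK' : IsCompact ((fun t => t - h) ⁻¹' K) :=
    (Homeomorph.subRight h).isCompact_preimage.2 hK
  have := ((measurePreserving_add_right volume h).integrableOn_comp_preimage
    (MeasurableEquiv.addRight h).measurableEmbedding).2 (hA _ hK')
  simpa [preimage_preimage, Function.comp_def] using this

/-- Testing an evolution equation with `η` produces the increment over `h` tested against `ψ`,
because `deriv η` is a difference of two shifts of `ψ`. The window only moves the support forward,
so it stays in positive times. -/
theorem isTest_window {ψ : ℝ → ℝ} (hψ : IsTest ψ) (hψ0 : tsupport ψ ⊆ Ioi 0) {h : ℝ}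
    (hh : 0 < h) {η : ℝ → ℝ} (hη : η = fun s => ∫ r in Ioc 0 h, ψ (s - r)) :
    IsTest η ∧ tsupport η ⊆ Ioi 0 ∧ ∀ s, deriv η s = ψ s - ψ (s - h) := by
  have hψc : Continuous ψ := hψ.1.continuous
  have hη' : ∀ s, η s = (∫ r in (0 : ℝ)..s, ψ r) - ∫ r in (0 : ℝ)..(s - h), ψ r := fun s => by
    rw [hη]
    beta_reduce
    rw [← intervalIntegral.integral_of_le hh.le, intervalIntegral.integral_comp_sub_left,
      intervalIntegral.integral_interval_sub_left (hψc.intervalIntegrable _ _)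
        (hψc.intervalIntegrable _ _), sub_zero]
  have hd : ∀ s, HasDerivAt η (ψ s - ψ (s - h)) s := fun s => by
    have hp : ∀ s, HasDerivAt (fun s => ∫ r in (0 : ℝ)..s, ψ r) (ψ s) s := fun s =>
      hψc.integral_hasStrictDerivAt 0 s |>.hasDerivAt
    have h2 : HasDerivAt (fun s => ∫ r in (0 : ℝ)..(s - h), ψ r) (ψ (s - h)) s := by
      simpa using (hp (s - h)).comp_sub_const s h
    rw [show η = fun s => _ from funext hη']
    exact (hp s).sub h2
  set K : Set ℝ := tsupport ψ + Icc 0 h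
  have hK : IsCompact K := hψ.2.isCompact.add isCompact_Icc
  have hKη : ∀ s, s ∉ K → η s = 0 := fun s hs => by
    rw [hη]
    refine (setIntegral_congr_fun measurableSet_Ioc fun r hr => ?_).trans
      (integral_zero ℝ ℝ)
    by_contra hne
    exact hs ⟨s - r, subset_tsupport _ hne, r, ⟨hr.1.le, hr.2⟩, by simp⟩
  refine ⟨⟨?_, HasCompactSupport.intro hK hKη⟩, ?_, fun s => (hd s).deriv⟩
  · refine contDiff_infty_iff_deriv.2 ⟨fun s => (hd s).differentiableAt, ?_⟩
    rw [show deriv η = fun s => ψ s - ψ (s - h) from funext fun s => (hd s).deriv]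
    exact hψ.1.sub (hψ.1.comp (contDiff_id.sub contDiff_const))
  · refine (closure_minimal (fun s hs => ?_) hK.isClosed).trans
      (show K ⊆ Ioi 0 from ?_)
    · by_contra hsK
      exact hs (hKη s hsK)
    · rintro _ ⟨a, ha, b, hb, rfl⟩
      exact add_pos_of_pos_of_nonneg (hψ0 ha) hb.1

/-- The identity is tested against an arbitrary `ψ` supported in `(0,∞)`: the equation is applied to
the window function of `ψ`, and Fubini's theorem moves the window from `ψ` to `F`. -/
theorem ae_increment_of_weak_derivative {A F : ℝ → ℝ} (hA : LocallyIntegrable A)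
    (hF : LocallyIntegrable F) (hFm : Measurable F)
    (hw : ∀ η : ℝ → ℝ, IsTest η → tsupport η ⊆ Ioi 0 →
      ∫ s, (-(deriv η s * A s) + η s * F s) = 0) {h : ℝ} (hh : 0 < h) :
    ∀ᵐ t, t ∈ Ioi (0 : ℝ) → A (t + h) - A t + ∫ r in Ioc 0 h, F (t + r) = 0 := by
  have hFi : ∀ a b, IntervalIntegrable F volume a b := fun a b =>
    (hF.integrableOn_isCompact isCompact_uIcc).intervalIntegrable
  refine isOpen_Ioi.ae_eq_zero_of_integral_contDiff_smul_eq_zero ?_ fun ψ hψ1 hψ2 hψ0 => ?_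
  · refine LocallyIntegrable.locallyIntegrableOn ?_ _
    refine ((locallyIntegrable_comp_add_right hA h).sub hA).add
      (Continuous.locallyIntegrable ?_)
    have hp := intervalIntegral.continuous_primitive hFi 0
    have : (fun t => ∫ r in Ioc 0 h, F (t + r))
        = fun t => (∫ r in (0 : ℝ)..(t + h), F r) - ∫ r in (0 : ℝ)..t, F r := by
      funext t
      rw [← intervalIntegral.integral_of_le hh.le, intervalIntegral.integral_comp_add_left,
        intervalIntegral.integral_interval_sub_left (hFi _ _) (hFi _ _), add_zero]
    rw [this]
    exact (hp.comp (by fun_prop)).sub hp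
  · have hψ : IsTest ψ := ⟨hψ1, hψ2⟩
    have hψc : Continuous ψ := hψ1.continuous
    set η : ℝ → ℝ := fun s => ∫ r in Ioc 0 h, ψ (s - r) with hη
    obtain ⟨hη1, hη2, hη3⟩ := isTest_window hψ hψ0 hh hη
    have hw' := hw η hη1 hη2
    have hAψ : Integrable fun t => ψ t * A t := by
      simpa using hA.integrable_smul_left_of_hasCompactSupport hψc hψ2
    have hAψ1 : Integrable fun t => ψ t * A (t + h) := by
      simpa using (locallyIntegrable_comp_add_right hA h).integrable_smul_left_of_hasCompactSupport
        hψc hψ2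
    have hAψ2 : Integrable fun t => ψ (t - h) * A t := by
      simpa using hAψ1.comp_sub_right h
    have hηF : Integrable fun t => η t * F t := by
      simpa using hF.integrable_smul_left_of_hasCompactSupport hη1.1.continuous hη1.2
    obtain ⟨C, hC⟩ := hψc.bounded_above_of_compact_support hψ2
    set K : Set ℝ := tsupport ψ + Icc 0 h
    have hK : IsCompact K := hψ2.isCompact.add isCompact_Icc
    have hi : Integrable (fun q : ℝ × ℝ => ψ (q.2 - q.1) * F q.2)
        ((volume.restrict (Ioc 0 h)).prod volume) := by
      have hb : Integrable (fun q : ℝ × ℝ => C * (K.indicator (fun s => ‖F s‖) q.2))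
          ((volume.restrict (Ioc 0 h)).prod volume) := by
        have h1 : Integrable (K.indicator fun s => ‖F s‖) :=
          IntegrableOn.integrable_indicator (hF.integrableOn_isCompact hK).norm hK.measurableSet
        exact (h1.comp_snd _).const_mul C
      refine hb.mono' (Measurable.aestronglyMeasurable ?_) ?_
      · exact (hψc.measurable.comp (by fun_prop)).mul (hFm.comp measurable_snd)
      have hm : ∀ᵐ q : ℝ × ℝ ∂((volume.restrict (Ioc 0 h)).prod volume), q.1 ∈ Ioc 0 h :=
        Measure.quasiMeasurePreserving_fst.ae (ae_restrict_mem measurableSet_Ioc)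
      filter_upwards [hm] with q hq
      rw [norm_mul]
      by_cases hqK : q.2 ∈ K
      · rw [indicator_of_mem hqK]
        exact mul_le_mul_of_nonneg_right (hC _) (norm_nonneg _)
      · have : ψ (q.2 - q.1) = 0 := by
          by_contra hne
          exact hqK ⟨q.2 - q.1, subset_tsupport _ hne, q.1, ⟨hq.1.le, hq.2⟩, by simp⟩
        simp [this, hqK]
    have hi' : Integrable (fun q : ℝ × ℝ => ψ q.2 * F (q.2 + q.1))
        ((volume.restrict (Ioc 0 h)).prod volume) := by
      -- The shear `(r, t) ↦ (r, t + r)` carries the integrability just proved over to the shifted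
      -- integrand, so that Fubini's theorem applies a second time.
      have hmp : MeasurePreserving (fun q : ℝ × ℝ => (q.1, q.2 + q.1))
          ((volume.restrict (Ioc 0 h)).prod volume) ((volume.restrict (Ioc 0 h)).prod volume) :=
        (MeasurePreserving.id _).skew_product (g := fun r t => t + r) (by fun_prop)
          (Eventually.of_forall fun r => (measurePreserving_add_right volume r).map_eq)
      simpa [Function.comp_def] using hmp.integrable_comp_of_integrable hi
    have e1 : ∫ s, η s * F s = ∫ t, ψ t * ∫ r in Ioc 0 h, F (t + r) := by
      calc ∫ s, η s * F s = ∫ s, ∫ r in Ioc 0 h, ψ (s - r) * F s := by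
            simp only [hη, integral_mul_const]
        _ = ∫ r in Ioc 0 h, ∫ s, ψ (s - r) * F s := (integral_integral_swap hi).symm
        _ = ∫ r in Ioc 0 h, ∫ t, ψ t * F (t + r) := by
            refine integral_congr_ae (Eventually.of_forall fun r => ?_)
            simpa using (integral_add_right_eq_self (fun s => ψ (s - r) * F s) r).symm
        _ = ∫ t, ∫ r in Ioc 0 h, ψ t * F (t + r) := integral_integral_swap hi'
        _ = _ := by simp only [integral_const_mul]
    have hψF : Integrable fun t => ψ t * ∫ r in Ioc 0 h, F (t + r) := by
      simpa [integral_const_mul] using hi'.integral_prod_right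
    have e2 : ∫ t, ψ (t - h) * A t = ∫ t, ψ t * A (t + h) := by
      simpa using (integral_add_right_eq_self (fun s => ψ (s - h) * A s) h).symm
    have e3 : ∀ t, -(deriv η t * A t) + η t * F t
        = (ψ (t - h) * A t - ψ t * A t) + η t * F t := fun t => by rw [hη3]; ring
    simp only [e3] at hw'
    have hs1 : Integrable fun t => ψ (t - h) * A t - ψ t * A t := hAψ2.sub hAψ
    have hs2 : Integrable fun t => ψ t * A (t + h) - ψ t * A t := hAψ1.sub hAψ
    rw [integral_add hs1 hηF, integral_sub hAψ2 hAψ, e1, e2] at hw'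
    simp only [smul_eq_mul, mul_add, mul_sub]
    rw [integral_add hs2 hψF, integral_sub hAψ1 hAψ]
    exact hw'

end

/-! ### Spatial averages of a weak solution of a transport-diffusion equation -/

/-- The average `x ↦ ∫ κ(y) f(t, x + y) dy` of a function on space-time. -/
noncomputable def spatialAverage (κ : Space → ℝ) (f : ℝ × Space → ℝ) (t : ℝ) (x : Space) : ℝ :=
  ∫ y, κ y * f (t, x + y)

/-- The average against `κ` of the distribution `- div G + g`. -/
noncomputable def averagedFlux (κ : Space → ℝ) (G : ℝ × Space → Space) (g : ℝ × Space → ℝ)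
    (t : ℝ) (x : Space) : ℝ :=
  ∫ y, (fderiv ℝ κ y (G (t, x + y)) + κ y * g (t, x + y))

/-- Weak form of `∂ₜf - div G + g = 0` on `(0,∞) × ℝ³`. -/
def IsWeakSolution (f : ℝ × Space → ℝ) (G : ℝ × Space → Space) (g : ℝ × Space → ℝ) : Prop :=
  ∀ φ : ℝ × Space → ℝ, IsTest φ → (∀ x, φ (0, x) = 0) →
    ∫ t in Ioi (0 : ℝ), ∫ x,
      (-(f (t, x) * dt φ t x) + dx φ t x (G (t, x)) + g (t, x) * φ (t, x)) = 0

section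

variable {κ : Space → ℝ} {f : ℝ × Space → ℝ} {G : ℝ × Space → Space} {g : ℝ × Space → ℝ}

theorem IsTest.measurable_fderiv_apply (hκ : IsTest κ) :
    Measurable fun q : Space × Space => fderiv ℝ κ q.1 q.2 := by
  have := hκ.1.continuous_fderiv (by simp)
  exact Continuous.measurable (by fun_prop)

theorem IsTest.lintegral_sq_ne_top (hκ : IsTest κ) : ∫⁻ y, ‖κ y‖ₑ ^ 2 ≠ ⊤ := by
  have := (hκ.1.continuous.memLp_of_hasCompactSupport (p := 2) (μ := volume) hκ.2).2
  rw [eLpNorm_lt_top_iff_lintegral_rpow_enorm_lt_top (by norm_num) (by norm_num)] at this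
  simpa using this.ne

theorem measurable_spatialAverage (hκ : IsTest κ) (hf : Measurable f) :
    Measurable fun q : ℝ × Space => spatialAverage κ f q.1 q.2 := by
  have hκm : Measurable κ := hκ.1.continuous.measurable
  refine (StronglyMeasurable.integral_prod_right (ν := volume)
    (f := fun (q : ℝ × Space) y => κ y * f (q.1, q.2 + y)) ?_).measurable
  exact Measurable.stronglyMeasurable (by simp only [Function.uncurry_def]; fun_prop)

theorem measurable_averagedFlux (hκ : IsTest κ) (hG : Measurable G) (hg : Measurable g) :
    Measurable fun q : ℝ × Space => averagedFlux κ G g q.1 q.2 := by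
  have hκm : Measurable κ := hκ.1.continuous.measurable
  refine (StronglyMeasurable.integral_prod_right (ν := volume)
    (f := fun (q : ℝ × Space) y => fderiv ℝ κ y (G (q.1, q.2 + y)) + κ y * g (q.1, q.2 + y))
    ?_).measurable
  refine Measurable.stronglyMeasurable (Measurable.add ?_ ?_)
  · exact hκ.measurable_fderiv_apply.comp
      (measurable_snd.prodMk (hG.comp (by fun_prop : Measurable fun z : (ℝ × Space) × Space =>
        (z.1.1, z.1.2 + z.2))))
  · exact (hκm.comp measurable_snd).mul (hg.comp (by fun_prop))

theorem enorm_sq_spatialAverage_le (hκ : IsTest κ) (hf : Measurable f) (t : ℝ) (x : Space) :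
    ‖spatialAverage κ f t x‖ₑ ^ 2 ≤ (∫⁻ y, ‖κ y‖ₑ ^ 2) * ∫⁻ y, ‖f (t, y)‖ₑ ^ 2 := by
  have hκm : Measurable κ := hκ.1.continuous.measurable
  calc ‖spatialAverage κ f t x‖ₑ ^ 2 ≤ (∫⁻ y, ‖κ y‖ₑ * ‖f (t, x + y)‖ₑ) ^ 2 := by
        refine pow_le_pow_left' ((enorm_integral_le_lintegral_enorm _).trans_eq ?_) 2
        simp only [enorm_mul]
    _ ≤ (∫⁻ y, ‖κ y‖ₑ ^ 2) * ∫⁻ y, ‖f (t, x + y)‖ₑ ^ 2 :=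
        sq_lintegral_mul_le (by fun_prop) (by fun_prop)
    _ = _ := by rw [lintegral_add_left_eq_self (fun y => ‖f (t, y)‖ₑ ^ 2) x]

theorem add_sq_le_two_mul (a b : ℝ≥0∞) : (a + b) ^ 2 ≤ 2 * a ^ 2 + 2 * b ^ 2 := by
  rw [← mul_add]
  rcases eq_or_ne a ⊤ with rfl | ha
  · simp
  rcases eq_or_ne b ⊤ with rfl | hb
  · simp
  lift a to ℝ≥0 using ha
  lift b to ℝ≥0 using hb
  exact_mod_cast add_sq_le (a := a) (b := b)

/-- The two terms use opposite endpoints of Young's inequality: `∇κ` in `L¹` against `G` in `L²`,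
and `κ` in `L²` against `g` in `L¹`. -/
theorem lintegral_sq_averagedFlux_le (hκ : IsTest κ) (hG : Measurable G) (hg : Measurable g)
    (t : ℝ) :
    ∫⁻ x, ‖averagedFlux κ G g t x‖ₑ ^ 2
      ≤ 2 * ((∫⁻ y, ‖fderiv ℝ κ y‖ₑ) ^ 2 * ∫⁻ x, ‖G (t, x)‖ₑ ^ 2)
        + 2 * ((∫⁻ y, ‖κ y‖ₑ ^ 2) * (∫⁻ x, ‖g (t, x)‖ₑ) ^ 2) := by
  have hκm : Measurable κ := hκ.1.continuous.measurable
  have hdm : Measurable fun y => ‖fderiv ℝ κ y‖ₑ :=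
    (hκ.1.continuous_fderiv (by simp)).measurable.enorm
  calc ∫⁻ x, ‖averagedFlux κ G g t x‖ₑ ^ 2
      ≤ ∫⁻ x, (2 * (∫⁻ y, ‖fderiv ℝ κ y‖ₑ * ‖G (t, x + y)‖ₑ) ^ 2
          + 2 * (∫⁻ y, ‖κ y‖ₑ * ‖g (t, x + y)‖ₑ) ^ 2) := by
        refine lintegral_mono fun x => ?_
        refine le_trans ?_ (add_sq_le_two_mul _ _)
        refine pow_le_pow_left' ((enorm_integral_le_lintegral_enorm _).trans ?_) 2
        rw [← lintegral_add_left (by fun_prop)]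
        refine lintegral_mono fun y => (enorm_add_le _ _).trans ?_
        rw [enorm_mul]
        gcongr
        exact ContinuousLinearMap.le_opENorm _ _
    _ = 2 * (∫⁻ x, (∫⁻ y, ‖fderiv ℝ κ y‖ₑ * ‖G (t, x + y)‖ₑ) ^ 2)
          + 2 * (∫⁻ x, (∫⁻ y, ‖κ y‖ₑ * ‖g (t, x + y)‖ₑ) ^ 2) := by
        rw [lintegral_add_left (by fun_prop), lintegral_const_mul _ (by fun_prop),
          lintegral_const_mul _ (by fun_prop)]
    _ ≤ _ := by
        gcongr
        · exact lintegral_sq_average_le (f := fun x => ‖G (t, x)‖ₑ) hdm (by fun_prop)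
        · exact lintegral_sq_average_le' (f := fun x => ‖g (t, x)‖ₑ) hκm.enorm (by fun_prop)

theorem isTest_mul_translate {η : ℝ → ℝ} (hη : IsTest η) (hκ : IsTest κ) (x : Space) :
    IsTest fun z : ℝ × Space => η z.1 * κ (z.2 - x) := by
  refine ⟨(hη.1.comp contDiff_fst).mul (hκ.1.comp (contDiff_snd.sub contDiff_const)), ?_⟩
  have hK : IsCompact (tsupport fun y => κ (y - x)) :=
    (hκ.2.comp_homeomorph (Homeomorph.subRight x)).isCompact
  refine HasCompactSupport.intro (hη.2.isCompact.prod hK) fun z hz => ?_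
  by_contra hne
  refine hz ⟨subset_tsupport _ (left_ne_zero_of_mul hne), subset_tsupport _ ?_⟩
  exact right_ne_zero_of_mul hne

theorem dt_mul_translate {η : ℝ → ℝ} (hη : IsTest η) (hκ : IsTest κ) (x : Space) (t : ℝ)
    (y : Space) : dt (fun z : ℝ × Space => η z.1 * κ (z.2 - x)) t y = deriv η t * κ (y - x) ∧
      ∀ v, dx (fun z : ℝ × Space => η z.1 * κ (z.2 - x)) t y v = η t * fderiv ℝ κ (y - x) v := by
  have h1 : HasFDerivAt (fun z : ℝ × Space => η z.1) (_ : ℝ × Space →L[ℝ] ℝ) (t, y) :=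
    ((hη.1.differentiable (by simp) t).hasFDerivAt).comp (t, y)
      (hasFDerivAt_fst (𝕜 := ℝ) (p := (t, y)))
  have h2 : HasFDerivAt (fun z : ℝ × Space => κ (z.2 - x)) (_ : ℝ × Space →L[ℝ] ℝ) (t, y) :=
    ((hκ.1.differentiable (by simp) (y - x)).hasFDerivAt).comp (t, y)
      ((hasFDerivAt_snd (𝕜 := ℝ) (p := (t, y))).sub_const x)
  have h := (h1.mul h2).fderiv
  refine ⟨?_, fun v => ?_⟩
  · unfold dt
    rw [show (fun z : ℝ × Space => η z.1 * κ (z.2 - x))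
      = (fun z : ℝ × Space => η z.1) * fun z : ℝ × Space => κ (z.2 - x) from rfl, h]
    simp [mul_comm]
  · unfold dx
    rw [show (fun z : ℝ × Space => η z.1 * κ (z.2 - x))
      = (fun z : ℝ × Space => η z.1) * fun z : ℝ × Space => κ (z.2 - x) from rfl, h]
    simp

theorem locallyIntegrable_of_lintegral_sq {B : ℝ → ℝ} (hB : Measurable B)
    (h : ∀ K : Set ℝ, IsCompact K → ∫⁻ t in K, ‖B t‖ₑ ^ 2 ≠ ⊤) : LocallyIntegrable B := by
  rw [locallyIntegrable_iff]
  intro K hK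
  refine ⟨hB.aestronglyMeasurable, ?_⟩
  have h1 := sq_lintegral_le (μ := volume.restrict K) (f := fun t => ‖B t‖ₑ) (by fun_prop)
  have h2 : (∫⁻ t in K, ‖B t‖ₑ) ^ 2 < ⊤ := by
    refine h1.trans_lt (ENNReal.mul_lt_top ?_ (h K hK).lt_top)
    simpa using hK.measure_lt_top
  exact (ENNReal.pow_lt_top_iff.1 h2).resolve_right (by norm_num)

/-- Averaging a weak solution in space gives a function with an integrable time derivative. -/
theorem IsWeakSolution.ae_increment_spatialAverage (hw : IsWeakSolution f G g) (hκ : IsTest κ)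
    (hf : Measurable f) (hG : Measurable G) (hg : Measurable g) {M : ℝ≥0∞} (hM : M ≠ ⊤)
    (hfM : ∀ᵐ t ∂(volume.restrict (Ioi (0 : ℝ))), ∫⁻ x, ‖f (t, x)‖ₑ ^ 2 ≤ M)
    (hfl : ∀ᵐ t ∂(volume.restrict (Ioi (0 : ℝ))), LocallyIntegrable fun x => f (t, x))
    (hGl : ∀ᵐ t ∂(volume.restrict (Ioi (0 : ℝ))), LocallyIntegrable fun x => G (t, x))
    (hgl : ∀ᵐ t ∂(volume.restrict (Ioi (0 : ℝ))), LocallyIntegrable fun x => g (t, x))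
    {x : Space} (hx : ∫⁻ t in Ioi (0 : ℝ), ‖averagedFlux κ G g t x‖ₑ ^ 2 ≠ ⊤)
    {h : ℝ} (hh : 0 < h) :
    ∀ᵐ t ∂(volume.restrict (Ioi (0 : ℝ))),
      spatialAverage κ f (t + h) x - spatialAverage κ f t x
        = - ∫ r in Ioc 0 h, averagedFlux κ G g (t + r) x := by
  have hAm : Measurable fun t => spatialAverage κ f t x :=
    (measurable_spatialAverage hκ hf).comp (by fun_prop : Measurable fun t : ℝ => (t, x))
  have hFm : Measurable fun t => averagedFlux κ G g t x :=
    (measurable_averagedFlux hκ hG hg).comp (by fun_prop : Measurable fun t : ℝ => (t, x))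
  -- Extension by zero allows the one-dimensional lemma on the whole line; its test functions live
  -- in positive times and do not see the jump at `0`.
  set A : ℝ → ℝ := (Ioi 0).indicator fun t => spatialAverage κ f t x with hA
  set F : ℝ → ℝ := (Ioi 0).indicator fun t => averagedFlux κ G g t x with hF
  have hsq : ∀ B : ℝ → ℝ, ∀ t, ‖(Ioi 0).indicator B t‖ₑ ^ 2
      = (Ioi 0).indicator (fun t => ‖B t‖ₑ ^ 2) t := fun B t => by
    by_cases ht : t ∈ Ioi (0 : ℝ) <;> simp [ht]
  have hAl : LocallyIntegrable A := by
    refine locallyIntegrable_of_lintegral_sq (hAm.indicator measurableSet_Ioi) fun K hK => ?_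
    refine ne_top_of_le_ne_top
      (b := ∫⁻ t in K, (∫⁻ y, ‖κ y‖ₑ ^ 2) * M) ?_ (lintegral_mono_ae ?_)
    · simpa using ENNReal.mul_ne_top (ENNReal.mul_ne_top hκ.lintegral_sq_ne_top hM) hK.measure_lt_top.ne
    · refine ae_restrict_of_ae ?_
      rw [ae_restrict_iff' measurableSet_Ioi] at hfM
      filter_upwards [hfM] with t ht
      rw [hA, hsq]
      by_cases ht0 : t ∈ Ioi (0 : ℝ)
      · rw [indicator_of_mem ht0]
        exact (enorm_sq_spatialAverage_le hκ hf t x).trans (by gcongr; exact ht ht0)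
      · simp [ht0]
  have hFl : LocallyIntegrable F := by
    refine locallyIntegrable_of_lintegral_sq (hFm.indicator measurableSet_Ioi) fun K hK => ?_
    refine ne_top_of_le_ne_top hx ?_
    simp only [hF, hsq]
    refine (setLIntegral_le_lintegral _ _).trans_eq ?_
    rw [lintegral_indicator measurableSet_Ioi]
  have key := ae_increment_of_weak_derivative hAl hFl (hFm.indicator measurableSet_Ioi)
    (fun η hη hη0 => ?_) hh
  · rw [ae_restrict_iff' measurableSet_Ioi]
    filter_upwards [key] with t ht ht0
    have h0 := ht ht0
    have hth : t + h ∈ Ioi (0 : ℝ) := add_pos ht0 hh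
    have hI : ∫ r in Ioc 0 h, F (t + r) = ∫ r in Ioc 0 h, averagedFlux κ G g (t + r) x := by
      refine setIntegral_congr_fun measurableSet_Ioc fun r hr => ?_
      have htr : t + r ∈ Ioi (0 : ℝ) := add_pos ht0 hr.1
      simp only [hF, indicator_of_mem htr]
    rw [hI, hA, indicator_of_mem ht0, indicator_of_mem hth] at h0
    linarith
  -- The equation is tested with the product `η(t) κ(y - x)`, which vanishes at `t = 0`. Its spatial
  -- integral is the average, respectively the averaged flux, at `x`.
  · have hφ := hw _ (isTest_mul_translate hη hκ x) (fun y => by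
      have : η 0 = 0 := by
        by_contra hne
        exact lt_irrefl (0 : ℝ) (hη0 (subset_tsupport _ hne))
      simp [this])
    rw [← hφ, ← integral_indicator measurableSet_Ioi]
    refine integral_congr_ae ?_
    rw [EventuallyEq]
    rw [ae_restrict_iff' measurableSet_Ioi] at hfl hGl hgl
    filter_upwards [hfl, hGl, hgl] with t h1 h2 h3
    by_cases ht : t ∈ Ioi (0 : ℝ)
    swap
    · simp [hA, hF, ht]
    rw [hA, hF, indicator_of_mem ht, indicator_of_mem ht, indicator_of_mem ht]
    simp only [(dt_mul_translate hη hκ x t _).1, (dt_mul_translate hη hκ x t _).2]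
    have i1 : Integrable fun y => κ (y - x) * f (t, y) := by
      simpa using (h1 ht).integrable_smul_left_of_hasCompactSupport (g := fun y => κ (y - x))
        (hκ.1.continuous.comp (by fun_prop)) (hκ.2.comp_homeomorph (Homeomorph.subRight x))
    have i3 : Integrable fun y => κ (y - x) * g (t, y) := by
      simpa using (h3 ht).integrable_smul_left_of_hasCompactSupport (g := fun y => κ (y - x))
        (hκ.1.continuous.comp (by fun_prop)) (hκ.2.comp_homeomorph (Homeomorph.subRight x))
    have i2 : Integrable fun y => fderiv ℝ κ (y - x) (G (t, y)) := by
      have := (h2 ht).integrable_smul_left_of_hasCompactSupport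
        (g := fun y => ‖fderiv ℝ κ (y - x)‖)
        ((hκ.1.continuous_fderiv (by simp)).norm.comp (by fun_prop))
        ((hκ.2.fderiv ℝ).norm.comp_homeomorph (Homeomorph.subRight x))
      refine this.mono (Measurable.aestronglyMeasurable ?_)
        (Eventually.of_forall fun y => ?_)
      · exact hκ.measurable_fderiv_apply.comp (by fun_prop :
          Measurable fun y : Space => (y - x, G (t, y)))
      · rw [norm_smul, norm_norm]; exact ContinuousLinearMap.le_opNorm _ _
    have e1 : spatialAverage κ f t x = ∫ y, κ (y - x) * f (t, y) := by
      rw [← integral_add_left_eq_self _ x]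
      simp [spatialAverage]
    have e2 : averagedFlux κ G g t x
        = ∫ y, (fderiv ℝ κ (y - x) (G (t, y)) + κ (y - x) * g (t, y)) := by
      rw [← integral_add_left_eq_self _ x]
      simp [averagedFlux]
    have j1 : Integrable fun y => -(deriv η t * (κ (y - x) * f (t, y))) := (i1.const_mul _).neg
    have j2 : Integrable fun y =>
        η t * (fderiv ℝ κ (y - x) (G (t, y)) + κ (y - x) * g (t, y)) := (i2.add i3).const_mul _
    rw [e1, e2, ← integral_const_mul, ← integral_const_mul, ← integral_neg,
      ← integral_add j1 j2]
    refine integral_congr_ae (Eventually.of_forall fun y => ?_)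
    simp only
    ring

end

/-! ### Mollifiers -/

theorem lintegral_comp_smul_space {a : ℝ} (ha : 0 < a) {F : Space → ℝ≥0∞} (hF : Measurable F) :
    ∫⁻ y, F (a⁻¹ • y) = ENNReal.ofReal (a ^ 3) * ∫⁻ y, F y := by
  have h := Measure.map_addHaar_smul (volume : Measure Space) (inv_ne_zero ha.ne')
  rw [← lintegral_map hF (measurable_const_smul _), h, lintegral_smul_measure, smul_eq_mul]
  congr 2
  rw [finrank_euclideanSpace_fin, abs_of_nonneg (by positivity)]
  simp

/-- Smooth probability densities at scale `a`, with the natural bounds. -/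
theorem exists_mollifier : ∃ c : ℝ≥0, ∀ a : ℝ, 0 < a → ∃ κ : Space → ℝ, IsTest κ ∧
    (∀ y, 0 ≤ κ y) ∧ ∫ y, κ y = 1 ∧ (∀ y, κ y ≠ 0 → ‖y‖ ≤ a) ∧
    ∫⁻ y, ‖fderiv ℝ κ y‖ₑ ≤ ENNReal.ofReal a⁻¹ * c ∧
    ∫⁻ y, ‖κ y‖ₑ ^ 2 ≤ ENNReal.ofReal (a ^ 3)⁻¹ * c := by
  let φ : ContDiffBump (0 : Space) := ⟨1 / 2, 1, by norm_num, by norm_num⟩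
  set k : Space → ℝ := φ.normed volume with hk
  have hkt : IsTest k := ⟨φ.contDiff_normed, φ.hasCompactSupport_normed⟩
  have hkd : Continuous (fderiv ℝ k) := hkt.1.continuous_fderiv (by simp)
  have hc1 : ∫⁻ y, ‖fderiv ℝ k y‖ₑ ≠ ⊤ :=
    (hkd.integrable_of_hasCompactSupport (hkt.2.fderiv ℝ)).2.ne
  have hc2 : ∫⁻ y, ‖k y‖ₑ ^ 2 ≠ ⊤ := hkt.lintegral_sq_ne_top
  -- The sum serves both bounds. For `a⁻³ k(y/a)` the gradient gains `a⁻¹` in `L¹`, and the squared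
  -- `L²` norm scales as `a⁻⁶ a³ = a⁻³`.
  refine ⟨((∫⁻ y, ‖fderiv ℝ k y‖ₑ) + ∫⁻ y, ‖k y‖ₑ ^ 2).toNNReal, fun a ha => ?_⟩
  rw [ENNReal.coe_toNNReal (ENNReal.add_ne_top.2 ⟨hc1, hc2⟩)]
  have ha3 : 0 < a ^ 3 := by positivity
  refine ⟨fun y => (a ^ 3)⁻¹ * k (a⁻¹ • y), ⟨?_, ?_⟩, fun y => ?_, ?_, fun y hy => ?_, ?_, ?_⟩
  · exact contDiff_const.mul (hkt.1.comp (contDiff_const_smul _))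
  · exact (hkt.2.comp_homeomorph (Homeomorph.smulOfNeZero a⁻¹ (inv_ne_zero ha.ne'))).mul_left
  · exact mul_nonneg (by positivity) (φ.nonneg_normed _)
  · rw [integral_const_mul, Measure.integral_comp_smul, φ.integral_normed,
      finrank_euclideanSpace_fin, abs_of_nonneg (by positivity)]
    field_simp
    simp
  · have h1 : a⁻¹ • y ∈ Function.support k := right_ne_zero_of_mul hy
    rw [hk, φ.support_normed_eq, mem_ball_zero_iff, norm_smul, norm_inv, Real.norm_of_nonneg ha.le,
      inv_mul_lt_iff₀ ha] at h1
    simpa [φ] using h1.le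
  · have hd : ∀ y, ‖fderiv ℝ (fun y => (a ^ 3)⁻¹ * k (a⁻¹ • y)) y‖ₑ
        = ENNReal.ofReal ((a ^ 3)⁻¹ * a⁻¹) * ‖fderiv ℝ k (a⁻¹ • y)‖ₑ := fun y => by
      have h1 : HasFDerivAt k (fderiv ℝ k (a⁻¹ • y)) (a⁻¹ • y) :=
        (hkt.1.differentiable (by simp) _).hasFDerivAt
      have h2 : HasFDerivAt (fun y : Space => a⁻¹ • y) (a⁻¹ • ContinuousLinearMap.id ℝ Space) y :=
        (hasFDerivAt_id y).const_smul a⁻¹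
      have h3 := ((h1.comp y h2).const_mul (a ^ 3)⁻¹).fderiv
      have h4 : fderiv ℝ (fun y => (a ^ 3)⁻¹ * k (a⁻¹ • y)) y
          = ((a ^ 3)⁻¹ * a⁻¹) • fderiv ℝ k (a⁻¹ • y) := by
        refine h3.trans ?_
        ext v
        simp [mul_assoc]
      rw [h4, enorm_smul, Real.enorm_of_nonneg (by positivity)]
    simp only [hd]
    rw [lintegral_const_mul _ (by fun_prop),
      lintegral_comp_smul_space ha (F := fun y => ‖fderiv ℝ k y‖ₑ) (by fun_prop),
      ← mul_assoc, ← ENNReal.ofReal_mul (by positivity)]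
    rw [show (a ^ 3)⁻¹ * a⁻¹ * a ^ 3 = a⁻¹ by field_simp]
    gcongr
    exact le_self_add
  · have hkm : Measurable k := hkt.1.continuous.measurable
    simp only [enorm_mul, mul_pow]
    rw [lintegral_const_mul _ (by fun_prop),
      lintegral_comp_smul_space ha (F := fun y => ‖k y‖ₑ ^ 2) (by fun_prop),
      Real.enorm_of_nonneg (by positivity), ← mul_assoc, ← ENNReal.ofReal_pow (by positivity),
      ← ENNReal.ofReal_mul (by positivity)]
    rw [show (a ^ 3)⁻¹ ^ 2 * a ^ 3 = (a ^ 3)⁻¹ by field_simp]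
    gcongr
    exact le_add_self

/-! ### Equicontinuity in time -/

theorem enorm_sub_add_sq_le (a b c : ℝ) :
    ‖a - b + c‖ₑ ^ 2 ≤ 4 * ‖a‖ₑ ^ 2 + 4 * ‖b‖ₑ ^ 2 + 2 * ‖c‖ₑ ^ 2 := by
  calc ‖a - b + c‖ₑ ^ 2 ≤ (‖a - b‖ₑ + ‖c‖ₑ) ^ 2 := pow_le_pow_left' (enorm_add_le _ _) 2
    _ ≤ 2 * ‖a - b‖ₑ ^ 2 + 2 * ‖c‖ₑ ^ 2 := add_sq_le_two_mul _ _
    _ ≤ 2 * (‖a‖ₑ + ‖b‖ₑ) ^ 2 + 2 * ‖c‖ₑ ^ 2 := by gcongr; exact enorm_sub_le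
    _ ≤ 2 * (2 * ‖a‖ₑ ^ 2 + 2 * ‖b‖ₑ ^ 2) + 2 * ‖c‖ₑ ^ 2 := by
        gcongr; exact add_sq_le_two_mul _ _
    _ = _ := by ring

theorem lintegral_Ioi_comp_add_le (F : ℝ → ℝ≥0∞) {h : ℝ} (hh : 0 ≤ h) :
    ∫⁻ t in Ioi 0, F (t + h) ≤ ∫⁻ t in Ioi 0, F t := by
  rw [← lintegral_indicator measurableSet_Ioi, ← lintegral_indicator measurableSet_Ioi,
    ← lintegral_add_right_eq_self (indicator (Ioi 0) F) h]
  refine lintegral_mono fun t => ?_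
  by_cases ht : t ∈ Ioi (0 : ℝ)
  · have hth : t + h ∈ Ioi (0 : ℝ) := add_pos_of_pos_of_nonneg ht hh
    simp only [indicator_of_mem ht, indicator_of_mem hth, le_refl]
  · simp only [indicator_of_notMem ht, zero_le]

variable {f : ℝ × Space → ℝ} {G : ℝ × Space → Space} {g : ℝ × Space → ℝ}

/-- The increment identity holds for fixed `x`, so time is integrated first. The space-time bound on
the flux makes it square integrable in time for almost every `x`, which is what the identity needs;
the time window then contributes `h²`. -/
theorem IsWeakSolution.lintegral_sq_increment_spatialAverage_le (hw : IsWeakSolution f G g)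
    (hf : Measurable f) (hG : Measurable G) (hg : Measurable g) {M N : ℝ≥0∞} (hM : M ≠ ⊤)
    (hN : N ≠ ⊤)
    (hfM : ∀ᵐ t ∂(volume.restrict (Ioi (0 : ℝ))), ∫⁻ x, ‖f (t, x)‖ₑ ^ 2 ≤ M)
    (hfG : ∀ᵐ t ∂(volume.restrict (Ioi (0 : ℝ))),
      HasWeakGradient (fun x => f (t, x)) fun x => G (t, x))
    (hGM : ∫⁻ t in Ioi (0 : ℝ), ∫⁻ x, ‖G (t, x)‖ₑ ^ 2 ≤ M)
    (hgN : ∫⁻ t in Ioi (0 : ℝ), (∫⁻ x, ‖g (t, x)‖ₑ) ^ 2 ≤ N)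
    {κ : Space → ℝ} (hκ : IsTest κ) {a b : ℝ≥0∞} (ha : a ≠ ⊤) (hb : b ≠ ⊤)
    (hκa : ∫⁻ y, ‖fderiv ℝ κ y‖ₑ ≤ a) (hκb : ∫⁻ y, ‖κ y‖ₑ ^ 2 ≤ b) {h : ℝ} (hh : 0 < h) :
    ∫⁻ t in Ioi (0 : ℝ), ∫⁻ x, ‖spatialAverage κ f (t + h) x - spatialAverage κ f t x‖ₑ ^ 2
      ≤ ENNReal.ofReal h ^ 2 * (2 * (a ^ 2 * M) + 2 * (b * N)) := by
  have hFm := measurable_averagedFlux hκ hG hg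
  have hAm := measurable_spatialAverage hκ hf
  have hflux : ∫⁻ x, ∫⁻ t in Ioi (0 : ℝ), ‖averagedFlux κ G g t x‖ₑ ^ 2
      ≤ 2 * (a ^ 2 * M) + 2 * (b * N) := by
    calc ∫⁻ x, ∫⁻ t in Ioi (0 : ℝ), ‖averagedFlux κ G g t x‖ₑ ^ 2
        = ∫⁻ t in Ioi (0 : ℝ), ∫⁻ x, ‖averagedFlux κ G g t x‖ₑ ^ 2 :=
          (lintegral_lintegral_swap (hFm.enorm.pow_const 2).aemeasurable).symm
      _ ≤ ∫⁻ t in Ioi (0 : ℝ), (2 * (a ^ 2 * ∫⁻ x, ‖G (t, x)‖ₑ ^ 2)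
            + 2 * (b * (∫⁻ x, ‖g (t, x)‖ₑ) ^ 2)) := by
          refine lintegral_mono fun t => (lintegral_sq_averagedFlux_le hκ hG hg t).trans ?_
          gcongr
      _ = 2 * (a ^ 2 * ∫⁻ t in Ioi (0 : ℝ), ∫⁻ x, ‖G (t, x)‖ₑ ^ 2)
            + 2 * (b * ∫⁻ t in Ioi (0 : ℝ), (∫⁻ x, ‖g (t, x)‖ₑ) ^ 2) := by
          rw [lintegral_add_left (by fun_prop), lintegral_const_mul _ (by fun_prop),
            lintegral_const_mul _ (by fun_prop), lintegral_const_mul _ (by fun_prop),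
            lintegral_const_mul _ (by fun_prop)]
      _ ≤ _ := by gcongr
  have hgl : ∀ᵐ t ∂(volume.restrict (Ioi (0 : ℝ))), LocallyIntegrable fun x => g (t, x) := by
    have hm : Measurable fun t => (∫⁻ x, ‖g (t, x)‖ₑ) ^ 2 := by fun_prop
    filter_upwards [ae_lt_top hm (ne_top_of_le_ne_top hN hgN)] with t ht
    refine Integrable.locallyIntegrable ⟨(hg.comp (by fun_prop)).aestronglyMeasurable, ?_⟩
    exact (ENNReal.pow_lt_top_iff.1 ht).resolve_right (by norm_num)
  have hfin : ∀ᵐ x, ∫⁻ t in Ioi (0 : ℝ), ‖averagedFlux κ G g t x‖ₑ ^ 2 < ⊤ := by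
    refine ae_lt_top ?_ (ne_top_of_le_ne_top ?_ hflux)
    · exact Measurable.lintegral_prod_left' (hFm.enorm.pow_const 2)
    · finiteness
  calc ∫⁻ t in Ioi (0 : ℝ), ∫⁻ x, ‖spatialAverage κ f (t + h) x - spatialAverage κ f t x‖ₑ ^ 2
      = ∫⁻ x, ∫⁻ t in Ioi (0 : ℝ), ‖spatialAverage κ f (t + h) x - spatialAverage κ f t x‖ₑ ^ 2 := by
        refine lintegral_lintegral_swap (Measurable.aemeasurable ?_)
        exact (((hAm.comp (by fun_prop : Measurable fun q : ℝ × Space => (q.1 + h, q.2))).sub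
          hAm).enorm.pow_const 2)
    _ ≤ ∫⁻ x, ENNReal.ofReal h ^ 2 * ∫⁻ t in Ioi (0 : ℝ), ‖averagedFlux κ G g t x‖ₑ ^ 2 := by
        refine lintegral_mono_ae ?_
        filter_upwards [hfin] with x hx
        have hFx : Measurable fun t => ‖averagedFlux κ G g t x‖ₑ :=
          (hFm.comp (by fun_prop : Measurable fun t : ℝ => (t, x))).enorm
        refine le_trans (lintegral_mono_ae ?_) (lintegral_sq_forward_average_le hFx h)
        filter_upwards [hw.ae_increment_spatialAverage hκ hf hG hg hM hfM
          (hfG.mono fun t ht => ht.1) (hfG.mono fun t ht => ht.2.1) hgl hx.ne hh] with t ht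
        rw [ht, enorm_neg]
        refine pow_le_pow_left' ((enorm_integral_le_lintegral_enorm _).trans_eq ?_) 2
        exact setLIntegral_congr Ioo_ae_eq_Ioc.symm
    _ = ENNReal.ofReal h ^ 2
          * ∫⁻ x, ∫⁻ t in Ioi (0 : ℝ), ‖averagedFlux κ G g t x‖ₑ ^ 2 :=
        lintegral_const_mul _ (Measurable.lintegral_prod_left' (hFm.enorm.pow_const 2))
    _ ≤ _ := by gcongr

/-- A weak solution with square integrable gradient is `L²`-equicontinuous in time; the modulus
depends only on the bounds on the solution. -/
theorem IsWeakSolution.lintegral_sq_increment_le (hw : IsWeakSolution f G g)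
    (hf : Measurable f) (hG : Measurable G) (hg : Measurable g) {M N : ℝ≥0∞} (hM : M ≠ ⊤)
    (hN : N ≠ ⊤)
    (hfM : ∀ᵐ t ∂(volume.restrict (Ioi (0 : ℝ))), ∫⁻ x, ‖f (t, x)‖ₑ ^ 2 ≤ M)
    (hfG : ∀ᵐ t ∂(volume.restrict (Ioi (0 : ℝ))),
      HasWeakGradient (fun x => f (t, x)) fun x => G (t, x))
    (hGM : ∫⁻ t in Ioi (0 : ℝ), ∫⁻ x, ‖G (t, x)‖ₑ ^ 2 ≤ M)
    (hgN : ∫⁻ t in Ioi (0 : ℝ), (∫⁻ x, ‖g (t, x)‖ₑ) ^ 2 ≤ N)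
    {κ : Space → ℝ} (hκ : IsTest κ) (hκ0 : ∀ y, 0 ≤ κ y) (hκ1 : ∫ y, κ y = 1) {α : ℝ}
    (hα : ∀ y, κ y ≠ 0 → ‖y‖ ≤ α) {a b : ℝ≥0∞} (ha : a ≠ ⊤) (hb : b ≠ ⊤)
    (hκa : ∫⁻ y, ‖fderiv ℝ κ y‖ₑ ≤ a) (hκb : ∫⁻ y, ‖κ y‖ₑ ^ 2 ≤ b) {h : ℝ} (hh : 0 < h) :
    ∫⁻ t in Ioi (0 : ℝ), ∫⁻ x, ‖f (t + h, x) - f (t, x)‖ₑ ^ 2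
      ≤ 8 * (ENNReal.ofReal α ^ 2 * M)
        + 2 * (ENNReal.ofReal h ^ 2 * (2 * (a ^ 2 * M) + 2 * (b * N))) := by
  have hAm := measurable_spatialAverage hκ hf
  let R : ℝ → ℝ≥0∞ := fun t => ∫⁻ x, ‖f (t, x) - spatialAverage κ f t x‖ₑ ^ 2
  have hRm : Measurable R :=
    Measurable.lintegral_prod_right' (f := fun q : ℝ × Space =>
      ‖f (q.1, q.2) - spatialAverage κ f q.1 q.2‖ₑ ^ 2) ((hf.sub hAm).enorm.pow_const 2)
  have hR : ∫⁻ t in Ioi (0 : ℝ), R t ≤ ENNReal.ofReal α ^ 2 * M := by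
    calc ∫⁻ t in Ioi (0 : ℝ), R t
        ≤ ∫⁻ t in Ioi (0 : ℝ), ENNReal.ofReal α ^ 2 * ∫⁻ x, ‖G (t, x)‖ₑ ^ 2 := by
          refine lintegral_mono_ae ?_
          filter_upwards [hfG] with t ht
          exact ht.lintegral_sq_sub_average_le (by fun_prop) (by fun_prop) hκ hκ0 hκ1 hα
      _ ≤ _ := by
          rw [lintegral_const_mul _ (by fun_prop)]
          gcongr
  have hAt : ∀ t, Measurable fun x => spatialAverage κ f t x := fun t =>
    hAm.comp (by fun_prop : Measurable fun x : Space => (t, x))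
  calc ∫⁻ t in Ioi (0 : ℝ), ∫⁻ x, ‖f (t + h, x) - f (t, x)‖ₑ ^ 2
      ≤ ∫⁻ t in Ioi (0 : ℝ), (4 * R (t + h) + 4 * R t
          + 2 * ∫⁻ x, ‖spatialAverage κ f (t + h) x - spatialAverage κ f t x‖ₑ ^ 2) := by
        refine lintegral_mono fun t => ?_
        have m1 := hAt t
        have m2 := hAt (t + h)
        simp only [R]
        rw [← lintegral_const_mul _ (by fun_prop), ← lintegral_const_mul _ (by fun_prop),
          ← lintegral_const_mul _ (by fun_prop), ← lintegral_add_left (by fun_prop),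
          ← lintegral_add_left (by fun_prop)]
        refine lintegral_mono fun x => ?_
        -- The increment splits into the smoothing error at `t + h`, minus that at `t`, plus the
        -- increment of the average.
        refine le_trans (le_of_eq ?_) (enorm_sub_add_sq_le _ _ _)
        congr 2
        ring
    _ = 4 * (∫⁻ t in Ioi (0 : ℝ), R (t + h)) + 4 * (∫⁻ t in Ioi (0 : ℝ), R t)
          + 2 * ∫⁻ t in Ioi (0 : ℝ), ∫⁻ x,
            ‖spatialAverage κ f (t + h) x - spatialAverage κ f t x‖ₑ ^ 2 := by
        rw [lintegral_add_left (by fun_prop), lintegral_add_left (by fun_prop),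
          lintegral_const_mul _ (by fun_prop), lintegral_const_mul _ (by fun_prop),
          lintegral_const_mul' _ _ (by norm_num)]
    _ ≤ 4 * (ENNReal.ofReal α ^ 2 * M) + 4 * (ENNReal.ofReal α ^ 2 * M)
          + 2 * (ENNReal.ofReal h ^ 2 * (2 * (a ^ 2 * M) + 2 * (b * N))) := by
        gcongr
        · exact (lintegral_Ioi_comp_add_le R hh.le).trans hR
        · exact hw.lintegral_sq_increment_spatialAverage_le hf hG hg hM hN hfM hfG hGM hgN hκ ha hb
            hκa hκb hh
    _ = _ := by ring

/-! ### Consequences of the energy inequality -/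

theorem iUnion_Ioo_zero_natCast : ⋃ n : ℕ, Ioo (0 : ℝ) n = Ioi 0 := by
  ext t
  simp only [mem_iUnion, mem_Ioo, mem_Ioi, exists_and_left, and_iff_left_iff_imp]
  exact fun _ => exists_nat_gt t

theorem aestronglyMeasurable_of_slab {F : Type*} [NormedAddCommGroup F] {f : ℝ × Space → F}
    (h : ∀ T : ℝ, 0 < T → AEStronglyMeasurable f (slab T)) :
    AEStronglyMeasurable f ((volume.restrict (Ioi (0 : ℝ))).prod volume) := by
  have hr : ∀ s : Set ℝ, (volume.restrict s).prod (volume : Measure Space)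
      = (volume.prod volume).restrict (s ×ˢ univ) := fun s => by
    rw [← Measure.prod_restrict, Measure.restrict_univ]
  rw [hr, ← iUnion_Ioo_zero_natCast, iUnion_prod_const, aestronglyMeasurable_iUnion_iff]
  intro n
  rw [← hr]
  rcases Nat.eq_zero_or_pos n with rfl | hn
  · simp
  · exact h n (by exact_mod_cast hn)

/-- The energy inequality holds only for almost every time, but beyond each `n` there is an
admissible one, and monotone convergence in `n` finishes. -/
theorem setLIntegral_Ioi_le_of_ae_le {d : ℝ → ℝ≥0∞} {E : ℝ≥0∞}
    (h : ∀ᵐ t ∂(volume.restrict (Ioi (0 : ℝ))), ∫⁻ s in Ioo 0 t, d s ≤ E) :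
    ∫⁻ s in Ioi (0 : ℝ), d s ≤ E := by
  rw [← iUnion_Ioo_zero_natCast, setLIntegral_iUnion_of_directed]
  · refine iSup_le fun n => ?_
    have h' : ∀ᵐ t ∂(volume.restrict (Ioi (n : ℝ))), ∫⁻ s in Ioo 0 t, d s ≤ E :=
      ae_restrict_of_ae_restrict_of_subset (Ioi_subset_Ioi (Nat.cast_nonneg n)) h
    have : (ae (volume.restrict (Ioi (n : ℝ)))).NeBot := by
      rw [ae_neBot, Ne, Measure.restrict_eq_zero]
      simp
    obtain ⟨t, ht, htn⟩ := (h'.and (ae_restrict_mem measurableSet_Ioi)).exists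
    exact (lintegral_mono_set (Ioo_subset_Ioo_right htn.le)).trans ht
  · exact Monotone.directed_le fun m n hmn => Ioo_subset_Ioo_right (by exact_mod_cast hmn)

/-- Cauchy–Schwarz in the plane, with `(½ div)² ≤ ¾ ∑ |D i|²`. It bounds the transport term by the
root of energy density times dissipation density. -/
theorem abs_inner_add_half_mul_le {v w : Space} {D : Fin 3 → Space} {c : ℝ} :
    |inner ℝ v w + 1 / 2 * (∑ i, D i i) * c|
      ≤ √(‖v‖ ^ 2 + c ^ 2) * √((∑ i, ‖D i‖ ^ 2) + ‖w‖ ^ 2) := by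
  set s := ∑ i, ‖D i‖ ^ 2 with hs
  set d := ∑ i, D i i with hd
  have hds : (1 / 2 * d) ^ 2 ≤ s := by
    have h1 : ∀ i, D i i ^ 2 ≤ ‖D i‖ ^ 2 := fun i => by
      rw [← sq_abs, ← Real.norm_eq_abs]
      exact pow_le_pow_left₀ (norm_nonneg _) (PiLp.norm_apply_le (D i) i) 2
    have h2 : d ^ 2 ≤ 3 * ∑ i, D i i ^ 2 := by
      simpa using sq_sum_le_card_mul_sum_sq (s := Finset.univ) (f := fun i => D i i)
    have h3 : ∑ i, D i i ^ 2 ≤ s := Finset.sum_le_sum fun i _ => h1 i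
    have h4 : 0 ≤ s := by positivity
    linarith [mul_pow (1 / 2 : ℝ) d 2]
  rw [← Real.sqrt_mul (by positivity)]
  apply Real.abs_le_sqrt
  have hvw : |inner ℝ v w| ≤ ‖v‖ * ‖w‖ := abs_real_inner_le_norm v w
  have h5 : |inner ℝ v w + 1 / 2 * d * c| ≤ ‖v‖ * ‖w‖ + |1 / 2 * d| * |c| := by
    refine (abs_add_le _ _).trans ?_
    rw [abs_mul (1 / 2 * d)]
    gcongr
  calc _ = |inner ℝ v w + 1 / 2 * d * c| ^ 2 := (sq_abs _).symm
    _ ≤ (‖v‖ * ‖w‖ + |1 / 2 * d| * |c|) ^ 2 := pow_le_pow_left₀ (abs_nonneg _) h5 2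
    _ ≤ (‖v‖ ^ 2 + |c| ^ 2) * (|1 / 2 * d| ^ 2 + ‖w‖ ^ 2) := by
        nlinarith [sq_nonneg (‖v‖ * |1 / 2 * d| - ‖w‖ * |c|)]
    _ ≤ _ := by rw [sq_abs, sq_abs]; gcongr

theorem HasWeakGradient.congr {f f' : Space → ℝ} {G G' : Space → Space} (h : HasWeakGradient f G)
    (hf : f =ᵐ[volume] f') (hG : G =ᵐ[volume] G') : HasWeakGradient f' G' := by
  refine ⟨h.1.congr hf, h.2.1.congr hG, fun ψ hψ i => ?_⟩
  rw [← integral_congr_ae (hf.mono fun x hx => congrArg (· * fderiv ℝ ψ x _) hx), h.2.2 ψ hψ i,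
    integral_congr_ae (hG.mono fun x hx => congrArg (fun v : Space => v i * ψ x) hx)]

variable {ε : ℝ} {u₀ : Space → Space} {θ₀ p₀ : Space → ℝ} {u : ℝ → Space → Space}
  {θ p : ℝ → Space → ℝ}

/-- The temperature of a finite energy weak solution is, up to null sets, a weak solution of a
transport-diffusion equation whose data are controlled by the initial energy. -/
theorem IsFiniteEnergyWeakSolution.exists_isWeakSolution (hε : 0 ≤ ε)
    (hs : IsFiniteEnergyWeakSolution ε u₀ θ₀ p₀ u θ p) {E : ℝ≥0∞} (hE : energy ε u₀ θ₀ p₀ ≤ E) :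
    ∃ (f : ℝ × Space → ℝ) (G : ℝ × Space → Space) (g : ℝ × Space → ℝ),
      Measurable f ∧ Measurable G ∧ Measurable g ∧ IsWeakSolution f G g ∧
      (∀ᵐ t ∂(volume.restrict (Ioi (0 : ℝ))), ∀ᵐ x, θ t x = f (t, x)) ∧
      (∀ᵐ t ∂(volume.restrict (Ioi (0 : ℝ))), ∫⁻ x, ‖f (t, x)‖ₑ ^ 2 ≤ 2 * E) ∧
      (∀ᵐ t ∂(volume.restrict (Ioi (0 : ℝ))),
        HasWeakGradient (fun x => f (t, x)) fun x => G (t, x)) ∧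
      ∫⁻ t in Ioi (0 : ℝ), ∫⁻ x, ‖G (t, x)‖ₑ ^ 2 ≤ 2 * E ∧
      ∫⁻ t in Ioi (0 : ℝ), (∫⁻ x, ‖g (t, x)‖ₑ) ^ 2 ≤ 2 * E * E := by
  obtain ⟨hu, hθ, -, Du, Dθ, hDu, hDθ, -, hT, -, hen⟩ := hs
  have mu := aestronglyMeasurable_of_slab fun T hT => (hu T hT).1
  have mθ := aestronglyMeasurable_of_slab fun T hT => (hθ T hT).1
  have mDu := fun i => aestronglyMeasurable_of_slab fun T hT => ((hDu i).1 T hT).1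
  have mDθ := aestronglyMeasurable_of_slab fun T hT => (hDθ.1 T hT).1
  -- Measurable representatives suffice: the equation, the gradient relation and the bounds see the
  -- functions only up to null sets in `x`, for almost every `t`.
  let u' := mu.mk
  let θ' := mθ.mk
  let Du' := fun i => (mDu i).mk
  let Dθ' := mDθ.mk
  have ku : Measurable u' := mu.stronglyMeasurable_mk.measurable
  have kθ : Measurable θ' := mθ.stronglyMeasurable_mk.measurable
  have kDu : ∀ i, Measurable (Du' i) := fun i => (mDu i).stronglyMeasurable_mk.measurable
  have kDθ : Measurable Dθ' := mDθ.stronglyMeasurable_mk.measurable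
  have eu : ∀ᵐ t ∂(volume.restrict (Ioi (0 : ℝ))), ∀ᵐ x, u t x = u' (t, x) :=
    Measure.ae_ae_of_ae_prod mu.ae_eq_mk
  have eθ : ∀ᵐ t ∂(volume.restrict (Ioi (0 : ℝ))), ∀ᵐ x, θ t x = θ' (t, x) :=
    Measure.ae_ae_of_ae_prod mθ.ae_eq_mk
  have eDu : ∀ᵐ t ∂(volume.restrict (Ioi (0 : ℝ))), ∀ i, ∀ᵐ x, Du i t x = Du' i (t, x) :=
    ae_all_iff.2 fun i => Measure.ae_ae_of_ae_prod (mDu i).ae_eq_mk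
  have eDθ : ∀ᵐ t ∂(volume.restrict (Ioi (0 : ℝ))), ∀ᵐ x, Dθ t x = Dθ' (t, x) :=
    Measure.ae_ae_of_ae_prod mDθ.ae_eq_mk
  let e : ℝ × Space → ℝ := fun z => ‖u' z‖ ^ 2 + θ' z ^ 2
  let d : ℝ × Space → ℝ := fun z => (∑ i, ‖Du' i z‖ ^ 2) + ‖Dθ' z‖ ^ 2
  have ke : Measurable e := by fun_prop
  have kd : Measurable d := by fun_prop
  -- The factor 2 undoes the `½` in the energy; the pressure term is nonnegative and is dropped.
  have he : ∀ᵐ t ∂(volume.restrict (Ioi (0 : ℝ))), ∫⁻ x, ENNReal.ofReal (e (t, x)) ≤ 2 * E := by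
    filter_upwards [hen, eu, eθ] with t ht h1 h2
    calc ∫⁻ x, ENNReal.ofReal (e (t, x))
        ≤ ∫⁻ x, 2 * ENNReal.ofReal
            (1 / 2 * ‖u t x‖ ^ 2 + 1 / 2 * θ t x ^ 2 + ε / 2 * p t x ^ 2) := by
          refine lintegral_mono_ae ?_
          filter_upwards [h1, h2] with x hx1 hx2
          refine le_trans (ENNReal.ofReal_le_ofReal (q := 2 *
            (1 / 2 * ‖u t x‖ ^ 2 + 1 / 2 * θ t x ^ 2 + ε / 2 * p t x ^ 2)) ?_)
            (by rw [ENNReal.ofReal_mul (by norm_num)]; simp)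
          simp only [e, ← hx1, ← hx2]
          have : 0 ≤ ε * p t x ^ 2 := by positivity
          linarith
      _ = 2 * energy ε (u t) (θ t) (p t) := lintegral_const_mul' _ _ (by norm_num)
      _ ≤ 2 * E := by
          gcongr
          exact le_self_add.trans (ht.trans hE)
  have hd : ∫⁻ t in Ioi (0 : ℝ), ∫⁻ x, ENNReal.ofReal (d (t, x)) ≤ E := by
    calc ∫⁻ t in Ioi (0 : ℝ), ∫⁻ x, ENNReal.ofReal (d (t, x))
        = ∫⁻ t in Ioi (0 : ℝ), ∫⁻ x, ENNReal.ofReal ((∑ i, ‖Du i t x‖ ^ 2) + ‖Dθ t x‖ ^ 2) := by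
          refine lintegral_congr_ae ?_
          filter_upwards [eDu, eDθ] with t h1 h2
          refine lintegral_congr_ae ?_
          filter_upwards [ae_all_iff.2 h1, h2] with x hx1 hx2
          simp only [d, hx1, hx2]
      _ ≤ E := setLIntegral_Ioi_le_of_ae_le (hen.mono fun t ht => le_add_self.trans (ht.trans hE))
  let g : ℝ × Space → ℝ := fun z => inner ℝ (u' z) (Dθ' z) + 1 / 2 * (∑ i, Du' i z i) * θ' z
  have kg : Measurable g := by
    have : ∀ i, Measurable fun z => Du' i z i := fun i =>
      (EuclideanSpace.proj (𝕜 := ℝ) i).measurable.comp (kDu i)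
    fun_prop
  refine ⟨θ', Dθ', g, kθ, kDθ, kg, fun φ hφ hφ0 => ?_, eθ, ?_, ?_, ?_, ?_⟩
  · have h := hT φ hφ
    simp only [hφ0, mul_zero, integral_zero] at h
    refine Eq.trans (integral_congr_ae ?_) h
    filter_upwards [eu, eθ, eDu, eDθ] with t h1 h2 h3 h4
    refine integral_congr_ae ?_
    filter_upwards [h1, h2, ae_all_iff.2 h3, h4] with x hx1 hx2 hx3 hx4
    simp only [g, divergence, hx1, hx2, hx3, hx4]
  · filter_upwards [he] with t ht
    refine (lintegral_mono fun x => ?_).trans ht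
    rw [Real.enorm_eq_ofReal_abs, ← ENNReal.ofReal_pow (abs_nonneg _), sq_abs]
    exact ENNReal.ofReal_le_ofReal (le_add_of_nonneg_left (by positivity))
  · filter_upwards [hDθ.2, eθ, eDθ] with t h1 h2 h3
    exact h1.congr h2 h3
  · refine le_trans ?_ (hd.trans (le_mul_of_one_le_left' (by norm_num)))
    refine lintegral_mono fun t => lintegral_mono fun x => ?_
    rw [← ofReal_norm, ← ENNReal.ofReal_pow (norm_nonneg _)]
    exact ENNReal.ofReal_le_ofReal (le_add_of_nonneg_left (by positivity))
  -- Cauchy–Schwarz in `x` leaves an energy factor bounded in time and a dissipation factor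
  -- integrable in time.
  · calc ∫⁻ t in Ioi (0 : ℝ), (∫⁻ x, ‖g (t, x)‖ₑ) ^ 2
        ≤ ∫⁻ t in Ioi (0 : ℝ), 2 * E * ∫⁻ x, ENNReal.ofReal (d (t, x)) := by
          refine lintegral_mono_ae ?_
          filter_upwards [he] with t ht
          have hsq : ∀ r : ℝ, 0 ≤ r → ENNReal.ofReal √r ^ 2 = ENNReal.ofReal r := fun r hr => by
            rw [← ENNReal.ofReal_pow (Real.sqrt_nonneg _), Real.sq_sqrt hr]
          calc (∫⁻ x, ‖g (t, x)‖ₑ) ^ 2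
              ≤ (∫⁻ x, ENNReal.ofReal √(e (t, x)) * ENNReal.ofReal √(d (t, x))) ^ 2 := by
                refine pow_le_pow_left' (lintegral_mono fun x => ?_) 2
                rw [← ENNReal.ofReal_mul (Real.sqrt_nonneg _), Real.enorm_eq_ofReal_abs]
                exact ENNReal.ofReal_le_ofReal abs_inner_add_half_mul_le
            _ ≤ (∫⁻ x, ENNReal.ofReal √(e (t, x)) ^ 2) * ∫⁻ x, ENNReal.ofReal √(d (t, x)) ^ 2 :=
                sq_lintegral_mul_le (by fun_prop) (by fun_prop)
            _ = (∫⁻ x, ENNReal.ofReal (e (t, x))) * ∫⁻ x, ENNReal.ofReal (d (t, x)) := by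
                congr 1
                · exact lintegral_congr fun x => hsq _ (by simp only [e]; positivity)
                · exact lintegral_congr fun x => hsq _ (by simp only [d]; positivity)
            _ ≤ _ := by gcongr
      _ = 2 * E * ∫⁻ t in Ioi (0 : ℝ), ∫⁻ x, ENNReal.ofReal (d (t, x)) :=
          lintegral_const_mul _ (by fun_prop)
      _ ≤ _ := by gcongr

theorem exists_bound_of_tendsto_zero {a : ℕ → ℝ≥0∞} (ha : ∀ n, a n ≠ ⊤)
    (h : Tendsto a atTop (𝓝 0)) : ∃ B : ℝ≥0, ∀ n, a n ≤ B := by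
  have h' : Tendsto (fun n => (a n).toNNReal) atTop (𝓝 0) := by
    exact (ENNReal.tendsto_toNNReal ENNReal.zero_ne_top).comp h
  obtain ⟨B, hB⟩ := h'.bddAbove_range
  refine ⟨B, fun n => ?_⟩
  rw [← ENNReal.coe_toNNReal (ha n)]
  exact_mod_cast hB ⟨n, rfl⟩

theorem lintegral_enorm_sq_eq {F : Type*} [NormedAddCommGroup F] (f : Space → F) :
    ∫⁻ x, ‖f x‖ₑ ^ 2 = eLpNorm f 2 volume ^ 2 := by
  have := eLpNorm_nnreal_pow_eq_lintegral (μ := (volume : Measure Space)) (f := f)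
    (p := 2) (by norm_num)
  simpa using this.symm

theorem energy_le (hε : 0 ≤ ε) (hu : AEStronglyMeasurable u₀) (hθ : AEStronglyMeasurable θ₀) :
    energy ε u₀ θ₀ p₀ ≤ eLpNorm u₀ 2 volume ^ 2 + eLpNorm θ₀ 2 volume ^ 2
      + eLpNorm (fun x => √ε * p₀ x) 2 volume ^ 2 := by
  rw [← lintegral_enorm_sq_eq, ← lintegral_enorm_sq_eq, ← lintegral_enorm_sq_eq,
    ← lintegral_add_left' (by fun_prop), ← lintegral_add_left' (by fun_prop)]
  refine lintegral_mono fun x => ?_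
  simp only [← ofReal_norm, ← ENNReal.ofReal_pow (norm_nonneg _)]
  rw [← ENNReal.ofReal_add (by positivity) (by positivity),
    ← ENNReal.ofReal_add (by positivity) (by positivity)]
  refine ENNReal.ofReal_le_ofReal ?_
  have h1 : ‖√ε * p₀ x‖ ^ 2 = ε * p₀ x ^ 2 := by
    rw [Real.norm_eq_abs, sq_abs, mul_pow, Real.sq_sqrt hε]
  rw [h1, Real.norm_eq_abs, sq_abs]
  have : 0 ≤ ε * p₀ x ^ 2 := by positivity
  nlinarith [sq_nonneg ‖u₀ x‖, sq_nonneg (θ₀ x)]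

/-- Convergence matters here only through boundedness of the initial norms. -/
theorem InitialDataConverge.exists_energy_bound {ε : ℕ → ℝ} (hε : ∀ n, 0 < ε n)
    {u₀ : ℕ → Space → Space} {θ₀ p₀ : ℕ → Space → ℝ} {u₀lim : Space → Space}
    {θ₀lim : Space → ℝ} (h : InitialDataConverge ε u₀ θ₀ p₀ u₀lim θ₀lim) :
    ∃ E : ℝ≥0, ∀ n, energy (ε n) (u₀ n) (θ₀ n) (p₀ n) ≤ E := by
  obtain ⟨hu, hθ, hp, hul, hθl, tu, tθ, tp⟩ := h
  obtain ⟨B₁, hB₁⟩ := exists_bound_of_tendsto_zero (fun n => ((hu n).sub hul).2.ne) tu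
  obtain ⟨B₂, hB₂⟩ := exists_bound_of_tendsto_zero (fun n => ((hθ n).sub hθl).2.ne) tθ
  obtain ⟨B₃, hB₃⟩ := exists_bound_of_tendsto_zero (fun n => ((hp n).const_mul √(ε n)).2.ne) tp
  have hbu : ∀ n, eLpNorm (u₀ n) 2 volume ≤ B₁ + eLpNorm u₀lim 2 volume := fun n => by
    calc eLpNorm (u₀ n) 2 volume = eLpNorm ((fun x => u₀ n x - u₀lim x) + u₀lim) 2 volume := by
          congr 1; ext1 x; simp
      _ ≤ _ := (eLpNorm_add_le ((hu n).sub hul).1 hul.1 (by norm_num)).trans (by gcongr; exact hB₁ n)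
  have hbθ : ∀ n, eLpNorm (θ₀ n) 2 volume ≤ B₂ + eLpNorm θ₀lim 2 volume := fun n => by
    calc eLpNorm (θ₀ n) 2 volume = eLpNorm ((fun x => θ₀ n x - θ₀lim x) + θ₀lim) 2 volume := by
          congr 1; ext1 x; simp
      _ ≤ _ := (eLpNorm_add_le ((hθ n).sub hθl).1 hθl.1 (by norm_num)).trans (by gcongr; exact hB₂ n)
  have hfin : (B₁ + eLpNorm u₀lim 2 volume) ^ 2 + (B₂ + eLpNorm θ₀lim 2 volume) ^ 2
      + (B₃ : ℝ≥0∞) ^ 2 ≠ ⊤ := by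
    have := hul.2.ne
    have := hθl.2.ne
    finiteness
  obtain ⟨E, hE⟩ := WithTop.ne_top_iff_exists.1 hfin
  refine ⟨E, fun n => ?_⟩
  change _ ≤ (WithTop.some E : ℝ≥0∞)
  rw [hE]
  refine (energy_le (hε n).le (hu n).1 (hθ n).1).trans ?_
  gcongr
  · exact hbu n
  · exact hbθ n
  · exact hB₃ n

/-- Here the time step is `a ^ 5`. The terms are of order `a²`, `a⁸` and `a⁷`, and `a ≤ 1` absorbs
the last two into the smoothing error. -/
theorem modulus_le {M N c : ℝ≥0} {a : ℝ} (ha : 0 < a) (ha1 : a ≤ 1) :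
    8 * (ENNReal.ofReal a ^ 2 * M) + 2 * (ENNReal.ofReal (a ^ 5) ^ 2
        * (2 * ((ENNReal.ofReal a⁻¹ * c) ^ 2 * M) + 2 * (ENNReal.ofReal (a ^ 3)⁻¹ * c * N)))
      ≤ ENNReal.ofReal (√(8 * M + 4 * c ^ 2 * M + 4 * c * N) * a) ^ 2 := by
  have hr : ∀ r : ℝ≥0, (r : ℝ≥0∞) = ENNReal.ofReal r := fun r => by simp
  have h2 : (2 : ℝ≥0∞) = ENNReal.ofReal 2 := by simp
  have h8 : (8 : ℝ≥0∞) = ENNReal.ofReal 8 := by simp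
  rw [hr M, hr N, hr c, h2, h8]
  have e : ∀ x y : ℝ, 0 ≤ x → ENNReal.ofReal x * ENNReal.ofReal y = ENNReal.ofReal (x * y) :=
    fun x y hx => (ENNReal.ofReal_mul hx).symm
  simp (disch := positivity) only [e, ← ENNReal.ofReal_pow, ← ENNReal.ofReal_add]
  refine ENNReal.ofReal_le_ofReal ?_
  rw [mul_pow √_ a, Real.sq_sqrt (by positivity)]
  have i1 : (a ^ 5) ^ 2 * (a⁻¹ * c) ^ 2 = a ^ 8 * (c : ℝ) ^ 2 := by field_simp
  have i2 : (a ^ 5) ^ 2 * ((a ^ 3)⁻¹ * c) = a ^ 7 * (c : ℝ) := by field_simp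
  have p8 : a ^ 8 ≤ a ^ 2 := pow_le_pow_of_le_one ha.le ha1 (by norm_num)
  have p7 : a ^ 7 ≤ a ^ 2 := pow_le_pow_of_le_one ha.le ha1 (by norm_num)
  calc _ = 8 * (a ^ 2 * M) + 4 * (((a ^ 5) ^ 2 * (a⁻¹ * c) ^ 2) * M)
        + 4 * (((a ^ 5) ^ 2 * ((a ^ 3)⁻¹ * c)) * N) := by ring
    _ = 8 * (a ^ 2 * M) + 4 * (a ^ 8 * (c : ℝ) ^ 2 * M) + 4 * (a ^ 7 * (c : ℝ) * N) := by
        rw [i1, i2]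
    _ ≤ 8 * (a ^ 2 * M) + 4 * (a ^ 2 * (c : ℝ) ^ 2 * M) + 4 * (a ^ 2 * (c : ℝ) * N) := by gcongr
    _ = _ := by ring

/-- A uniform Hölder modulus of continuity in time for the temperature. -/
theorem exists_modulus_temperature (E : ℝ≥0) : ∃ C : ℝ, ∀ (ε : ℝ) (u₀ : Space → Space)
    (θ₀ p₀ : Space → ℝ) (u : ℝ → Space → Space) (θ p : ℝ → Space → ℝ), 0 ≤ ε →
    IsFiniteEnergyWeakSolution ε u₀ θ₀ p₀ u θ p → energy ε u₀ θ₀ p₀ ≤ E →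
    ∀ h ∈ Ioo (0 : ℝ) 1, ∀ T : ℝ,
      eLpNorm (fun z : ℝ × Space => θ (z.1 + h) z.2 - θ z.1 z.2) 2 (slab T)
        ≤ ENNReal.ofReal (C * h ^ (1 / 5 : ℝ)) := by
  obtain ⟨c, hc⟩ := exists_mollifier
  -- The constant of `modulus_le` for `M = 2E` and `N = 2E²`, the bounds supplied by the energy
  -- inequality.
  refine ⟨√(8 * (2 * E : ℝ≥0) + 4 * c ^ 2 * (2 * E : ℝ≥0) + 4 * c * (2 * E * E : ℝ≥0)), ?_⟩
  intro ε u₀ θ₀ p₀ u θ p hε hs hE h hh T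
  obtain ⟨f, G, g, hf, hG, hg, hw, hθf, hfM, hfG, hGM, hgN⟩ := hs.exists_isWeakSolution hε hE
  have ha : 0 < h ^ (1 / 5 : ℝ) := Real.rpow_pos_of_pos hh.1 _
  have ha1 : h ^ (1 / 5 : ℝ) ≤ 1 := Real.rpow_le_one hh.1.le hh.2.le (by norm_num)
  have ha5 : (h ^ (1 / 5 : ℝ)) ^ 5 = h := by
    rw [← Real.rpow_natCast, ← Real.rpow_mul hh.1.le]; norm_num
  obtain ⟨κ, hκ, hκ0, hκ1, hκs, hκa, hκb⟩ := hc _ ha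
  have key := hw.lintegral_sq_increment_le hf hG hg (by finiteness) (by finiteness) hfM hfG hGM
    hgN hκ hκ0 hκ1 hκs (by finiteness) (by finiteness) hκa hκb hh.1
  set a := h ^ (1 / 5 : ℝ)
  have hmod := modulus_le (M := 2 * E) (N := 2 * E * E) (c := c) ha ha1
  rw [ha5] at hmod
  have hθh : ∀ᵐ t ∂(volume.restrict (Ioi (0 : ℝ))), ∀ᵐ x, θ (t + h) x = f (t + h, x) := by
    rw [ae_restrict_iff' measurableSet_Ioi] at hθf ⊢
    filter_upwards [(measurePreserving_add_right volume h).quasiMeasurePreserving.ae hθf]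
      with t ht ht0
    exact ht (add_pos ht0 hh.1)
  have hsq : eLpNorm (fun z : ℝ × Space => θ (z.1 + h) z.2 - θ z.1 z.2) 2 (slab T) ^ 2
      ≤ ENNReal.ofReal (√(8 * (2 * E : ℝ≥0) + 4 * c ^ 2 * (2 * E : ℝ≥0)
        + 4 * c * (2 * E * E : ℝ≥0)) * a) ^ 2 := by
    calc eLpNorm (fun z : ℝ × Space => θ (z.1 + h) z.2 - θ z.1 z.2) 2 (slab T) ^ 2
        = ∫⁻ z, ‖θ (z.1 + h) z.2 - θ z.1 z.2‖ₑ ^ 2 ∂(slab T) := by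
          have := eLpNorm_nnreal_pow_eq_lintegral (μ := slab T) (p := 2)
            (f := fun z : ℝ × Space => θ (z.1 + h) z.2 - θ z.1 z.2) (by norm_num)
          simpa using this
      -- This half of Tonelli's theorem needs no measurability, so `θ` itself may be kept here and
      -- replaced by its representative afterwards.
      _ ≤ ∫⁻ t in Ioo 0 T, ∫⁻ x, ‖θ (t + h) x - θ t x‖ₑ ^ 2 := lintegral_prod_le _
      _ ≤ ∫⁻ t in Ioi 0, ∫⁻ x, ‖θ (t + h) x - θ t x‖ₑ ^ 2 :=
          lintegral_mono_set Ioo_subset_Ioi_self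
      _ = ∫⁻ t in Ioi 0, ∫⁻ x, ‖f (t + h, x) - f (t, x)‖ₑ ^ 2 := by
          refine lintegral_congr_ae ?_
          filter_upwards [hθf, hθh] with t h1 h2
          refine lintegral_congr_ae ?_
          filter_upwards [h1, h2] with x hx1 hx2
          rw [hx1, hx2]
      _ ≤ _ := key.trans (le_trans (le_of_eq (by push_cast; rfl)) hmod)
  exact (ENNReal.pow_le_pow_left_iff two_ne_zero).1 hsq

end NSF

theorem mainTheorem6
    (ε : ℕ → ℝ) (hε : ∀ n, 0 < ε n) (hε_lim : Tendsto ε atTop (𝓝 0))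
    (u₀ : ℕ → NSF.Space → NSF.Space) (θ₀ p₀ : ℕ → NSF.Space → ℝ)
    (u₀lim : NSF.Space → NSF.Space) (θ₀lim : NSF.Space → ℝ)
    (hID : NSF.InitialDataConverge ε u₀ θ₀ p₀ u₀lim θ₀lim)
    (u : ℕ → ℝ → NSF.Space → NSF.Space) (θ p : ℕ → ℝ → NSF.Space → ℝ)
    (hsol : ∀ n, NSF.IsFiniteEnergyWeakSolution (ε n) (u₀ n) (θ₀ n) (p₀ n) (u n) (θ n) (p n))
    (T : ℝ) (hT : 0 < T) :
    ∃ C : ℝ, ∀ n : ℕ, ∀ h : ℝ, h ∈ Ioo (0 : ℝ) 1 →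
      eLpNorm (fun z : ℝ × NSF.Space => θ n (z.1 + h) z.2 - θ n z.1 z.2) 2 (NSF.slab T)
        ≤ ENNReal.ofReal (C * h ^ (1 / 5 : ℝ)) := by
  obtain ⟨E, hE⟩ := hID.exists_energy_bound hε
  obtain ⟨C, hC⟩ := NSF.exists_modulus_temperature E
  exact ⟨C, fun n h hh => hC _ _ _ _ _ _ _ (hε n).le (hsol n) (hE n) h hh T⟩
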